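/- Let $F$ be an infinite field containing a primitive fifth root of unity $\rho$ (so $\operatorname{char} F\neq 5$), let $\alpha,\beta\in F^\times$, and let $A=F[x,y : x^5=\alpha,\ y^5=\beta,\ yx=\rho xy]$ be the corresponding cyclic algebra of degree $5$. An element $a\in A$ is called $5$-central if $a^5$ is in the center of $A$ and $a^k$ is not in the center for $1\le k\le 4$; an $F$-subspace of $A$ is called $5$-central if all its nonzero elements are $5$-central. Let $V\subseteq A$ be a $5$-central subspace with $\dim_F V\ge 4$. Suppose that $V$ contains $x$, $y$ and some monomial $x^iy^j$ ($i,j\geq 0$) such that $x$, $y$, $x^iy^j$ are linearly independent over $F$. Then $V$ is contained in one of the following spaces: $$F[x]y+Fx,\qquad F[y]x+Fy,\qquad F[x^3y^2]x+F(x^3y^2)^i\ \text{ for some } 1\le i\le 4 .$$ Moreover, if $V$ is maximal with respect to inclusion among the $5$-central subspaces of $A$, then $\dim_F V=6$. -/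

import Mathlib

/-- The defining relations `x ^ d = α`, `y ^ d = β`, `y x = ρ x y` of a symbol algebra,
on the free algebra with generators `x = ι 0` and `y = ι 1`. -/
inductive SymbolRel {F : Type*} [Field F] (d : ℕ) (ρ α β : F) :
    FreeAlgebra F (Fin 2) → FreeAlgebra F (Fin 2) → Prop
  | x_pow : SymbolRel d ρ α β (FreeAlgebra.ι F 0 ^ d) (algebraMap F _ α)
  | y_pow : SymbolRel d ρ α β (FreeAlgebra.ι F 1 ^ d) (algebraMap F _ β)
  | y_mul_x : SymbolRel d ρ α β (FreeAlgebra.ι F 1 * FreeAlgebra.ι F 0)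
      (ρ • (FreeAlgebra.ι F 0 * FreeAlgebra.ι F 1))

/-- The cyclic (symbol) algebra
`(α, β)_{d,F} = F[x, y : x ^ d = α, y ^ d = β, y x = ρ x y]`. -/
abbrev SymbolAlgebra {F : Type*} [Field F] (d : ℕ) (ρ α β : F) : Type _ :=
  RingQuot (SymbolRel d ρ α β)

/-- The standard generator `x` of the symbol algebra. -/
noncomputable def SymbolAlgebra.x {F : Type*} [Field F] (d : ℕ) (ρ α β : F) :
    SymbolAlgebra d ρ α β :=
  RingQuot.mkAlgHom F (SymbolRel d ρ α β) (FreeAlgebra.ι F 0)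

/-- The standard generator `y` of the symbol algebra. -/
noncomputable def SymbolAlgebra.y {F : Type*} [Field F] (d : ℕ) (ρ α β : F) :
    SymbolAlgebra d ρ α β :=
  RingQuot.mkAlgHom F (SymbolRel d ρ α β) (FreeAlgebra.ι F 1)

/-- A noncentral element `a` is `d`-central if `a ^ d` is central and `a ^ k` is not central
for `1 ≤ k ≤ d - 1`. -/
def IsDCentral {A : Type*} [Ring A] (d : ℕ) (a : A) : Prop :=
  a ∉ Set.center A ∧ a ^ d ∈ Set.center A ∧
    ∀ k : ℕ, 1 ≤ k → k < d → a ^ k ∉ Set.center A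

/-- A `d`-central space: a subspace all of whose nonzero elements are `d`-central. -/
def IsDCentralSpace {F A : Type*} [Field F] [Ring A] [Algebra F A] (d : ℕ)
    (V : Submodule F A) : Prop :=
  ∀ v ∈ V, v ≠ 0 → IsDCentral d v

/-- The subspace `F[w] z + F u`. -/
noncomputable def adjoinMulAddSpan (F : Type*) {A : Type*} [Field F] [Ring A] [Algebra F A]
    (w z u : A) : Submodule F A :=
  (Subalgebra.toSubmodule (Algebra.adjoin F {w})).map (LinearMap.mulRight F z) ⊔
    Submodule.span F {u}

/-!
The monomials `x ^ i * y ^ j` with exponents in `ZMod 5 × ZMod 5` form a basis of `A`. Two of them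
commute up to a power of `ρ`, whose exponent is the determinant of the two exponent vectors, and any
two with nonzero determinant are again standard generators of `A`.

If all fifth powers of elements of `V` are central, interpolating `(s • u + v) ^ 5` at the fifth
roots of unity and at `0` shows that the sum of all words with `p` letters `u` and `5 - p` letters
`v` is central for all `u`, `v` in `V`. Taking monomials of `V` for `u` makes the linear and
quadratic parts of these expressions constrain the coefficients of an arbitrary element of `V`: some
monomials cannot occur at all, and some pairs of coefficients have product zero, so that one of the
two vanishes on all of `V`. A finite check over the exponent of the third monomial leaves the
exponents of the three standard families.

For the third family, let `w = x ^ 3 * y ^ 2`, so that the elements of `V` are `f(w) x + g(w)` with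
`g` having no constant term. The fifth power of such an element is `N(f(w)) x ^ 5 + g(w) ^ 5`, and
`F[w]` is a field unless `w ^ 5` is a fifth power in `F`; hence `g(w) ^ 5` is central for every
element of `V`, and this forces `g` to be a multiple of one fixed monomial. If `w ^ 5 = c ^ 5`
with `c ∈ F`, then vanishing of `f` at `c` and at `ρ c` imposes only two linear conditions and makes
`(f(w) x) ^ 4` vanish, so no three-dimensional `5`-central space consists of elements `f(w) x`. The
same remark shows that each of the standard spaces containing a space `V` of dimension at least `4`
is itself `5`-central, and it has dimension `6`.
-/

open Finset Module

section Interpolation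

variable {F M : Type*} [Field F] [AddCommGroup M] [Module F M] {n : ℕ} {N : Submodule F M}
  {T : ℕ → M}

theorem mem_of_forall_sum_pow_smul_mem {S : Finset F} (hS : n ≤ #S)
    (h : ∀ s ∈ S, ∑ l ∈ range n, s ^ l • T l ∈ N) {l : ℕ} (hl : l < n) : T l ∈ N := by
  rw [← Submodule.Quotient.mk_eq_zero, ← Module.forall_dual_apply_eq_zero_iff F]
  intro f
  let p : Polynomial F := ∑ l ∈ range n, .monomial l (f (N.mkQ (T l)))
  have hp : p = 0 := by
    refine Polynomial.eq_zero_of_degree_lt_of_eval_finset_eq_zero S ?_ fun s hs => ?_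
    · refine (Polynomial.degree_sum_le _ _).trans_lt ((Finset.sup_lt_iff ?_).2 fun l hl => ?_)
      · exact WithBot.bot_lt_coe _
      · exact (Polynomial.degree_monomial_le _ _).trans_lt
          (by exact_mod_cast (mem_range.1 hl).trans_le hS)
    · have hsum : f (N.mkQ (∑ l ∈ range n, s ^ l • T l)) = 0 := by
        rw [N.mkQ_apply, (Submodule.Quotient.mk_eq_zero N).2 (h s hs), map_zero]
      simpa only [p, Polynomial.eval_finsetSum, Polynomial.eval_monomial, map_sum, map_smul,
        smul_eq_mul, mul_comm] using hsum
  have hcoeff : p.coeff l = 0 := by rw [hp, Polynomial.coeff_zero]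
  simpa [p, Polynomial.finsetSum_coeff, Polynomial.coeff_monomial, hl] using hcoeff

variable {d : ℕ} {r : F}

theorem mem_of_forall_root_sum_pow_smul_mem (hr : IsPrimitiveRoot r d)
    (h : ∀ s : F, s ^ d = 1 → ∑ l ∈ range d, s ^ l • T l ∈ N) {l : ℕ} (hl : l < d) : T l ∈ N := by
  have hd : 0 < d := hl.pos
  refine mem_of_forall_sum_pow_smul_mem (S := Polynomial.nthRootsFinset d 1)
    hr.card_nthRootsFinset.ge (fun s hs => h s ?_) hl
  exact (Polynomial.mem_nthRootsFinset hd 1).1 hs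

theorem mem_of_forall_sum_range_succ_pow_smul_mem [NeZero d] (hr : IsPrimitiveRoot r d)
    (h : ∀ s : F, ∑ l ∈ range (d + 1), s ^ l • T l ∈ N) {l : ℕ} (hl : l ≤ d) : T l ∈ N := by
  have h0 : (0 : F) ∉ Polynomial.nthRootsFinset d 1 := by
    simp [Polynomial.mem_nthRootsFinset (NeZero.pos d), NeZero.ne d]
  refine mem_of_forall_sum_pow_smul_mem (S := .cons 0 (Polynomial.nthRootsFinset d 1) h0)
    ?_ (fun s _ => h s) (Nat.lt_succ_of_le hl)
  rw [card_cons, hr.card_nthRootsFinset]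

end Interpolation

section Shuffle

/-- The sum of all words obtained by inserting `p` letters `u` into the word `l`; it is the
coefficient of `s ^ p` in products of factors `s • u + v` with `v` running through `l`. -/
def shuffle {A : Type*} [Semiring A] (u : A) : ℕ → List A → A
  | 0, l => l.prod
  | p + 1, [] => u ^ (p + 1)
  | p + 1, v :: l => u * shuffle u p (v :: l) + v * shuffle u (p + 1) l

/-- The scalar by which `shuffle u p l` differs from `u ^ p * l.prod`, where the argument lists the
factors picked up when `u` is moved to the left past each letter of `l`. -/
def shuffleCoeff {F : Type*} [Semiring F] : ℕ → List F → F
  | 0, _ => 1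
  | _ + 1, [] => 1
  | p + 1, r :: l => shuffleCoeff p (r :: l) + r ^ (p + 1) * shuffleCoeff (p + 1) l

variable {F A : Type*} [Field F] [Ring A] [Algebra F A]

@[simp]
theorem shuffle_zero (u : A) (l : List A) : shuffle u 0 l = l.prod := by
  rw [shuffle]

@[simp]
theorem shuffle_nil (u : A) (p : ℕ) : shuffle u p [] = u ^ p := by
  cases p <;> simp [shuffle]

theorem shuffle_append_add (u : A) (p : ℕ) (l l' : List A) (v v' : A) :
    shuffle u p (l ++ (v + v') :: l') =
      shuffle u p (l ++ v :: l') + shuffle u p (l ++ v' :: l') := by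
  induction p generalizing l with
  | zero => simp [mul_add, add_mul]
  | succ p ih =>
    induction l with
    | nil =>
      have := ih []
      simp only [List.nil_append, shuffle] at this ⊢
      rw [this]
      noncomm_ring
    | cons t l ihl =>
      have := ih (t :: l)
      simp only [List.cons_append, shuffle] at this ⊢
      rw [this, ihl]
      noncomm_ring

theorem shuffle_append_smul (u : A) (p : ℕ) (l l' : List A) (c : F) (v : A) :
    shuffle u p (l ++ (c • v) :: l') = c • shuffle u p (l ++ v :: l') := by
  induction p generalizing l with
  | zero => simp
  | succ p ih =>
    induction l with
    | nil =>
      have := ih []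
      simp only [List.nil_append, shuffle] at this ⊢
      rw [this, smul_mul_assoc, mul_smul_comm, smul_add]
    | cons t l ihl =>
      have := ih (t :: l)
      simp only [List.cons_append, shuffle] at this ⊢
      rw [this, ihl, mul_smul_comm, mul_smul_comm, smul_add]

theorem shuffle_smul_left (c : F) (u : A) (p : ℕ) (l : List A) :
    shuffle (c • u) p l = c ^ p • shuffle u p l := by
  induction p generalizing l with
  | zero => simp
  | succ p ih =>
    induction l with
    | nil => rw [shuffle, shuffle, smul_pow]
    | cons v l ihl =>
      rw [shuffle, shuffle, ih, ihl, smul_mul_smul_comm, ← pow_succ', mul_smul_comm, smul_add]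

theorem add_pow_eq_sum_shuffle (u v : A) (n : ℕ) :
    (u + v) ^ n = ∑ k ∈ antidiagonal n, shuffle u k.1 (.replicate k.2 v) := by
  induction n with
  | zero => simp
  | succ n ih =>
    have hu : u * (u + v) ^ n = ∑ k ∈ antidiagonal (n + 1),
        if k.1 = 0 then 0 else u * shuffle u (k.1 - 1) (.replicate k.2 v) := by
      rw [ih, mul_sum, Nat.sum_antidiagonal_succ]
      simp
    have hv : v * (u + v) ^ n = ∑ k ∈ antidiagonal (n + 1),
        if k.2 = 0 then 0 else v * shuffle u k.1 (.replicate (k.2 - 1) v) := by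
      rw [ih, mul_sum, Nat.sum_antidiagonal_succ']
      simp
    rw [pow_succ', add_mul, hu, hv, ← sum_add_distrib]
    refine sum_congr rfl fun ⟨p, k⟩ hpk => ?_
    rcases p with - | p <;> rcases k with - | k
    · simp at hpk
    · simp [List.replicate_succ]
    · simp [pow_succ']
    · simp [shuffle, List.replicate_succ]

theorem shuffle_eq_smul {u : A} {l : List A} {M : List F}
    (hl : List.Forall₂ (fun v r => v * u = r • (u * v)) l M) (p : ℕ) :
    shuffle u p l = shuffleCoeff p M • (u ^ p * l.prod) := by
  induction p generalizing l M with
  | zero => simp [shuffleCoeff]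
  | succ p ih =>
    induction hl with
    | nil => simp [shuffleCoeff]
    | @cons v r l M hvr hl ihl =>
      have hpow : v * u ^ (p + 1) = r ^ (p + 1) • (u ^ (p + 1) * v) := by
        have := SemiconjBy.pow_right (a := v) (x := u) (y := r • u) (by
          rw [SemiconjBy, hvr, smul_mul_assoc]) (p + 1)
        rw [this.eq, smul_pow, smul_mul_assoc]
      rw [shuffle, shuffleCoeff, ih (.cons hvr hl), ihl, mul_smul_comm, mul_smul_comm, ← mul_assoc,
        ← mul_assoc, hpow, List.prod_cons, smul_mul_assoc, smul_smul, ← pow_succ', add_smul,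
        mul_assoc, mul_comm (r ^ _)]

theorem shuffle_replicate_mem {d : ℕ} [NeZero d] {r : F} (hr : IsPrimitiveRoot r d)
    {N : Submodule F A} {u v : A} (h : ∀ s : F, (s • u + v) ^ d ∈ N) {p k : ℕ} (hpk : p + k = d) :
    shuffle u p (.replicate k v) ∈ N := by
  obtain rfl : k = d - p := by lia
  refine mem_of_forall_sum_range_succ_pow_smul_mem
    (T := fun p => shuffle u p (.replicate (d - p) v)) hr (fun s => ?_) (by lia : p ≤ d)
  have hs := h s
  simpa only [add_pow_eq_sum_shuffle, Nat.sum_antidiagonal_eq_sum_range_succ_mk,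
    shuffle_smul_left] using hs

end Shuffle

/-- The elements `w` and `z` are standard generators of a symbol algebra `(a, b)_{d,F}`. -/
structure IsSymbolPair {F A : Type*} [Field F] [Ring A] [Algebra F A] (d : ℕ) (q a b : F)
    (w z : A) : Prop where
  prim : IsPrimitiveRoot q d
  left_ne_zero : a ≠ 0
  right_ne_zero : b ≠ 0
  left_pow : w ^ d = algebraMap F A a
  right_pow : z ^ d = algebraMap F A b
  right_mul_left : z * w = q • (w * z)
  adjoin_eq_top : Algebra.adjoin F {w, z} = ⊤

/-- The determinant of two vectors; it governs the commutation of monomials of a symbol algebra. -/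
def det₂ {R : Type*} [CommRing R] (m n : R × R) : R := m.1 * n.2 - m.2 * n.1

/-- The monomial `w ^ i * z ^ j` with exponent vector `n = (i, j)`; the exponents may be read modulo
`d` because `w ^ d` and `z ^ d` are nonzero scalars in a symbol algebra. -/
def mono {A : Type*} [Monoid A] {d : ℕ} (w z : A) (n : ZMod d × ZMod d) : A :=
  w ^ n.1.val * z ^ n.2.val

theorem mono_one_zero {A : Type*} [Monoid A] {d : ℕ} [Fact (1 < d)] (w z : A) :
    mono w z ((1, 0) : ZMod d × ZMod d) = w := by
  simp [mono, ZMod.val_one]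

theorem mono_zero_one {A : Type*} [Monoid A] {d : ℕ} [Fact (1 < d)] (w z : A) :
    mono w z ((0, 1) : ZMod d × ZMod d) = z := by
  simp [mono, ZMod.val_one]

namespace IsSymbolPair

variable {F A : Type*} [Field F] [Ring A] [Algebra F A] {d : ℕ} {q a b : F} {w z : A}
  (h : IsSymbolPair d q a b w z)

include h in
theorem pow_mul_pow_eq_smul_mono (i j : ℕ) :
    ∃ c : Fˣ, w ^ i * z ^ j = c • mono w z ((i, j) : ZMod d × ZMod d) := by
  refine ⟨Units.mk0 (a ^ (i / d) * b ^ (j / d))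
    (mul_ne_zero (pow_ne_zero _ h.left_ne_zero) (pow_ne_zero _ h.right_ne_zero)), ?_⟩
  rw [mono, ZMod.val_natCast, ZMod.val_natCast, Units.smul_mk0, Algebra.smul_def]
  nth_rw 1 [← Nat.div_add_mod i d, ← Nat.div_add_mod j d]
  rw [pow_add, pow_add, pow_mul, pow_mul, h.left_pow, h.right_pow, ← map_pow, ← map_pow, map_mul]
  rw [mul_assoc, mul_assoc, ← mul_assoc (w ^ _), ← Algebra.commutes, mul_assoc]

variable [NeZero d]

/-- The character `i ↦ q ^ i` of `ZMod d`. -/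
noncomputable def char (h : IsSymbolPair d q a b w z) : AddChar (ZMod d) F :=
  AddChar.zmodChar d h.prim.pow_eq_one

include h

theorem swap : IsSymbolPair d q⁻¹ b a z w where
  prim := h.prim.inv
  left_ne_zero := h.right_ne_zero
  right_ne_zero := h.left_ne_zero
  left_pow := h.right_pow
  right_pow := h.left_pow
  right_mul_left := by rw [h.right_mul_left, inv_smul_smul₀ (h.prim.ne_zero (NeZero.ne d))]
  adjoin_eq_top := by rw [Set.pair_comm, h.adjoin_eq_top]

theorem char_natCast (i : ℕ) : h.char i = q ^ i :=
  AddChar.zmodChar_apply' _ i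

theorem char_eq_one_iff {i : ZMod d} : h.char i = 1 ↔ i = 0 := by
  rw [char, AddChar.zmodChar_apply, h.prim.pow_eq_one_iff_dvd]
  exact ⟨fun hi => (ZMod.val_eq_zero i).1 (Nat.eq_zero_of_dvd_of_lt hi i.val_lt),
    fun hi => by simp [hi]⟩

theorem char_injective : Function.Injective h.char := fun i j hij => by
  have := h.char_eq_one_iff (i := i - j)
  rwa [AddChar.map_sub_eq_div, hij, div_self (h.char.val_isUnit j).ne_zero, eq_self, true_iff,
    sub_eq_zero] at this

theorem char_ne_zero (i : ZMod d) : h.char i ≠ 0 :=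
  (h.char.val_isUnit i).ne_zero

theorem isUnit_left : IsUnit w := by
  rw [← isUnit_pow_iff (NeZero.ne d), h.left_pow]
  exact (IsUnit.mk0 a h.left_ne_zero).map _

theorem isUnit_right : IsUnit z := by
  rw [← isUnit_pow_iff (NeZero.ne d), h.right_pow]
  exact (IsUnit.mk0 b h.right_ne_zero).map _

theorem isUnit_mono (n : ZMod d × ZMod d) : IsUnit (mono w z n) :=
  (h.isUnit_left.pow _).mul (h.isUnit_right.pow _)

theorem right_pow_mul_left_pow (i j : ℕ) : z ^ j * w ^ i = h.char (j * i) • (w ^ i * z ^ j) := by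
  have h₁ : SemiconjBy z w (q • w) := by rw [SemiconjBy, h.right_mul_left, smul_mul_assoc]
  have h₂ : SemiconjBy (w ^ i) z (q⁻¹ ^ i • z) := by
    have hq : q ^ i ≠ 0 := pow_ne_zero _ (h.prim.ne_zero (NeZero.ne d))
    rw [SemiconjBy, smul_mul_assoc, (h₁.pow_right i).eq, smul_pow, smul_mul_assoc, smul_smul,
      inv_pow, inv_mul_cancel₀ hq, one_smul]
  have hqij : q ^ (j * i) ≠ 0 := pow_ne_zero _ (h.prim.ne_zero (NeZero.ne d))
  rw [(h₂.pow_right j).eq, smul_pow, smul_mul_assoc, smul_smul, ← pow_mul, inv_pow, mul_comm i,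
    ← Nat.cast_mul, h.char_natCast, mul_inv_cancel₀ hqij, one_smul]

theorem mono_mul_mono_eq (m n : ZMod d × ZMod d) : mono w z m * mono w z n =
    h.char (m.2 * n.1) • (w ^ (m.1.val + n.1.val) * z ^ (m.2.val + n.2.val)) := by
  have := h.right_pow_mul_left_pow n.1.val m.2.val
  rw [ZMod.natCast_zmod_val, ZMod.natCast_zmod_val] at this
  rw [mono, mono, mul_assoc, ← mul_assoc (z ^ _), this, smul_mul_assoc, mul_smul_comm, pow_add,
    pow_add, mul_assoc, mul_assoc]

theorem mono_mul_comm (m n : ZMod d × ZMod d) :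
    mono w z m * mono w z n = h.char (det₂ n m) • (mono w z n * mono w z m) := by
  rw [h.mono_mul_mono_eq, h.mono_mul_mono_eq, add_comm m.1.val, add_comm m.2.val, smul_smul,
    ← AddChar.map_add_eq_mul]
  congr 2
  rw [det₂]
  ring

theorem mono_mul_mono (m n : ZMod d × ZMod d) :
    ∃ c : Fˣ, mono w z m * mono w z n = c • mono w z (m + n) := by
  obtain ⟨c, hc⟩ := h.pow_mul_pow_eq_smul_mono (m.1.val + n.1.val) (m.2.val + n.2.val)
  refine ⟨Units.mk0 _ (h.char_ne_zero (m.2 * n.1)) * c, ?_⟩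
  rw [h.mono_mul_mono_eq, hc, mul_smul, Units.smul_mk0, Nat.cast_add, Nat.cast_add]
  simp only [ZMod.natCast_val, ZMod.cast_id', id_eq]
  rfl

theorem mono_pow (n : ZMod d × ZMod d) (k : ℕ) :
    ∃ c : Fˣ, mono w z n ^ k = c • mono w z (k • n) := by
  induction k with
  | zero => exact ⟨1, by simp [mono]⟩
  | succ k ih =>
    obtain ⟨c, hc⟩ := ih
    obtain ⟨c', hc'⟩ := h.mono_mul_mono (k • n) n
    exact ⟨c * c', by rw [pow_succ, hc, smul_mul_assoc, hc', smul_smul, succ_nsmul]⟩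

theorem mono_pow_eq_algebraMap (n : ZMod d × ZMod d) :
    ∃ c : Fˣ, mono w z n ^ d = algebraMap F A c := by
  obtain ⟨c, hc⟩ := h.mono_pow n d
  refine ⟨c, ?_⟩
  rw [hc, Algebra.algebraMap_eq_smul_one, Units.smul_def]
  simp [mono]

theorem mono_mem_adjoin_mono_mono {m n : ZMod d × ZMod d} (i j : ℕ) :
    mono w z (i • m + j • n) ∈ Algebra.adjoin F {mono w z m, mono w z n} := by
  obtain ⟨c, hc⟩ := h.mono_pow m i
  obtain ⟨c', hc'⟩ := h.mono_pow n j
  obtain ⟨c'', hc''⟩ := h.mono_mul_mono (i • m) (j • n)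
  have hmem : mono w z m ^ i * mono w z n ^ j ∈
      Algebra.adjoin F {mono w z m, mono w z n} :=
    mul_mem (pow_mem (Algebra.subset_adjoin (by simp)) _)
      (pow_mem (Algebra.subset_adjoin (by simp)) _)
  rw [hc, hc', smul_mul_smul_comm, hc'', smul_smul] at hmem
  have hinv := Subalgebra.smul_mem _ hmem ((c * c' * c'')⁻¹ : Fˣ).val
  rwa [← Units.smul_def, inv_smul_smul] at hinv

theorem sum_filter_eq_zero {ι : Type*} {s : Finset ι} {f : ι → A} {e : ι → ZMod d} {u : A}
    (hu : IsUnit u) (hf : ∀ i ∈ s, u * f i = h.char (e i) • (f i * u)) (hsum : ∑ i ∈ s, f i = 0)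
    (k : ZMod d) : ∑ i ∈ s with e i = k, f i = 0 := by
  have hpow (j : ℕ) {i : ι} (hi : i ∈ s) : u ^ j * f i = h.char (e i) ^ j • (f i * u ^ j) := by
    induction j with
    | zero => simp
    | succ j ih =>
      rw [pow_succ', mul_assoc, ih, mul_smul_comm, ← mul_assoc, hf i hi, smul_mul_assoc, smul_smul,
        mul_assoc, pow_succ]
  have hchar (j : ℕ) : ∑ i ∈ s, h.char (e i) ^ j • f i = 0 := by
    refine ((hu.pow j).mul_left_inj).1 ?_
    rw [zero_mul, ← mul_zero (u ^ j), ← hsum, mul_sum, sum_mul]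
    exact sum_congr rfl fun i hi => by rw [hpow j hi, smul_mul_assoc]
  have hk := mem_of_forall_root_sum_pow_smul_mem (N := (⊥ : Submodule F A)) (l := k.val)
    (T := fun l => ∑ i ∈ s with (e i).val = l, f i) h.prim (fun t ht => ?_) k.val_lt
  · simpa only [Submodule.mem_bot, (ZMod.val_injective d).eq_iff] using hk
  · obtain ⟨j, -, rfl⟩ := h.prim.eq_pow_of_pow_eq_one ht
    rw [Submodule.mem_bot, ← hchar j]
    simp_rw [smul_sum, sum_filter]
    rw [sum_comm]
    refine sum_congr rfl fun i _ => ?_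
    rw [sum_ite_eq, if_pos (mem_range.2 (e i).val_lt), char, AddChar.zmodChar_apply, pow_right_comm]

theorem left_mul_mono (n : ZMod d × ZMod d) :
    w * mono w z n = h.char (-n.2) • (mono w z n * w) := by
  have := h.right_pow_mul_left_pow 1 n.2.val
  rw [pow_one, Nat.cast_one, mul_one, ZMod.natCast_zmod_val] at this
  rw [mono, mul_assoc (w ^ _), this, mul_smul_comm, smul_smul, ← AddChar.map_add_eq_mul,
    neg_add_cancel, AddChar.map_zero_eq_one, one_smul, ← mul_assoc, ← mul_assoc, pow_mul_comm']

theorem right_mul_mono (n : ZMod d × ZMod d) :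
    z * mono w z n = h.char n.1 • (mono w z n * z) := by
  have := h.right_pow_mul_left_pow n.1.val 1
  rw [pow_one, Nat.cast_one, one_mul, ZMod.natCast_zmod_val] at this
  rw [mono, ← mul_assoc, this, smul_mul_assoc, mul_assoc, mul_assoc, pow_mul_comm']

theorem linearIndependent_mono [Nontrivial A] :
    LinearIndependent F (mono w z : ZMod d × ZMod d → A) := by
  rw [Fintype.linearIndependent_iff]
  intro g hg n
  have hw (m : ZMod d × ZMod d) :
      w * g m • mono w z m = h.char (-m.2) • (g m • mono w z m * w) := by
    rw [mul_smul_comm, h.left_mul_mono, smul_comm, smul_mul_assoc]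
  have hz (m : ZMod d × ZMod d) :
      z * g m • mono w z m = h.char m.1 • (g m • mono w z m * z) := by
    rw [mul_smul_comm, h.right_mul_mono, smul_comm, smul_mul_assoc]
  have h₂ := h.sum_filter_eq_zero h.isUnit_left (fun m _ => hw m) hg (-n.2)
  have h₁ := h.sum_filter_eq_zero h.isUnit_right (fun m _ => hz m) h₂ n.1
  have hn : ({m | -m.2 = -n.2} : Finset (ZMod d × ZMod d)).filter (·.1 = n.1) = {n} := by
    ext m
    simp [Prod.ext_iff, and_comm]
  rw [hn, sum_singleton] at h₁
  exact (smul_eq_zero.1 h₁).resolve_right (h.isUnit_mono n).ne_zero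

theorem span_mono_eq_top :
    Submodule.span F (Set.range (mono w z : ZMod d × ZMod d → A)) = ⊤ := by
  have hclosure (u : A) (hu : u ∈ Submonoid.closure {w, z}) :
      ∃ (c : Fˣ) (n : ZMod d × ZMod d), u = c • mono w z n := by
    induction hu using Submonoid.closure_induction with
    | mem u hu =>
      rcases hu with rfl | rfl
      · obtain ⟨c, hc⟩ := h.pow_mul_pow_eq_smul_mono 1 0
        exact ⟨c, _, by simpa using hc⟩
      · obtain ⟨c, hc⟩ := h.pow_mul_pow_eq_smul_mono 0 1
        exact ⟨c, _, by simpa using hc⟩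
    | one => exact ⟨1, 0, by simp [mono]⟩
    | mul u v _ _ hu hv =>
      obtain ⟨c, m, rfl⟩ := hu
      obtain ⟨c', n, rfl⟩ := hv
      obtain ⟨c'', hc''⟩ := h.mono_mul_mono m n
      exact ⟨c * c' * c'', m + n, by rw [smul_mul_smul_comm, hc'', smul_smul]⟩
  rw [← top_le_iff, ← Algebra.top_toSubmodule, ← h.adjoin_eq_top, Algebra.adjoin_eq_span,
    Submodule.span_le]
  intro u hu
  obtain ⟨c, n, rfl⟩ := hclosure u hu
  exact Submodule.smul_mem _ c.val (Submodule.subset_span ⟨n, rfl⟩)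

/-- The basis of a symbol algebra consisting of the monomials in its standard generators. -/
noncomputable def basis [Nontrivial A] : Basis (ZMod d × ZMod d) F A :=
  .mk h.linearIndependent_mono h.span_mono_eq_top.ge

theorem basis_apply [Nontrivial A] (n : ZMod d × ZMod d) : h.basis n = mono w z n :=
  Basis.mk_apply ..

theorem sum_repr_smul_mono [Nontrivial A] (u : A) : ∑ n, h.basis.repr u n • mono w z n = u := by
  simpa only [h.basis_apply] using h.basis.sum_repr u

theorem repr_mono [Nontrivial A] (n : ZMod d × ZMod d) :
    h.basis.repr (mono w z n) = Finsupp.single n 1 := by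
  rw [← h.basis_apply, Basis.repr_self]

theorem finite [Nontrivial A] : Module.Finite F A :=
  .of_basis h.basis

omit [NeZero d] in
theorem mem_center_of_commute {u : A} (hw : Commute w u) (hz : Commute z u) :
    u ∈ Set.center A := by
  have hle : Algebra.adjoin F {w, z} ≤ Subalgebra.centralizer F {u} := by
    refine Algebra.adjoin_le ?_
    rintro t (rfl | rfl) s rfl
    exacts [hw.eq.symm, hz.eq.symm]
  rw [h.adjoin_eq_top] at hle
  exact Semigroup.mem_center_iff.2 fun t => (hle (Algebra.mem_top : t ∈ ⊤) u rfl).symm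

theorem char_det₂_eq_of_mono_mul_eq_smul [Nontrivial A] {u : A} {c : F} {k n : ZMod d × ZMod d}
    (hu : mono w z k * u = c • (u * mono w z k)) (hn : h.basis.repr u n ≠ 0) :
    h.char (det₂ n k) = c := by
  have hconj : ∑ m, (h.char (det₂ m k) * h.basis.repr u m) • mono w z m = c • u := by
    refine (h.isUnit_mono k).mul_left_inj.1 ?_
    rw [smul_mul_assoc, ← hu]
    conv_rhs => rw [← h.sum_repr_smul_mono u]
    rw [sum_mul, mul_sum]
    refine sum_congr rfl fun m _ => ?_
    rw [mul_smul_comm, h.mono_mul_comm k m, smul_mul_assoc, smul_smul, mul_comm]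
  refine mul_right_cancel₀ hn ?_
  simpa [h.repr_mono, Finsupp.single_apply] using congr(h.basis.repr $hconj n)

theorem repr_eq_zero_of_mem_center [Nontrivial A] {u : A} (hu : u ∈ Set.center A)
    {n : ZMod d × ZMod d} (hn : n ≠ 0) : h.basis.repr u n = 0 := by
  by_contra hne
  have hdet (k : ZMod d × ZMod d) : det₂ n k = 0 := h.char_eq_one_iff.1 <|
    h.char_det₂_eq_of_mono_mul_eq_smul
      (by rw [one_smul, Semigroup.mem_center_iff.1 hu (mono w z k)]) hne
  exact hn (Prod.ext (by simpa [det₂] using hdet (0, 1)) (by simpa [det₂] using hdet (1, 0)))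

theorem isSymbolPair_mono {m n : ZMod d × ZMod d} (hmn : IsUnit (det₂ m n)) :
    ∃ a' b' : F, IsSymbolPair d (h.char (det₂ m n)) a' b' (mono w z m) (mono w z n) := by
  obtain ⟨a', ha'⟩ := h.mono_pow_eq_algebraMap m
  obtain ⟨b', hb'⟩ := h.mono_pow_eq_algebraMap n
  refine ⟨a', b', ?_, a'.ne_zero, b'.ne_zero, ha', hb', h.mono_mul_comm n m, ?_⟩
  · obtain ⟨t, ht⟩ := hmn
    rw [← ht, char, AddChar.zmodChar_apply]
    exact h.prim.pow_of_coprime _ (ZMod.val_coe_unit_coprime t)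
  · rw [← Algebra.toSubmodule_eq_top, ← top_le_iff, ← h.span_mono_eq_top, Submodule.span_le]
    rintro _ ⟨k, rfl⟩
    obtain ⟨t, ht⟩ := hmn.exists_left_inv
    have hcramer : k = (t * det₂ k n) • m + (t * det₂ m k) • n := by
      ext <;> simp only [Prod.fst_add, Prod.snd_add, Prod.smul_fst, Prod.smul_snd, smul_eq_mul]
      · simp only [det₂] at ht ⊢
        linear_combination -k.1 * ht
      · simp only [det₂] at ht ⊢
        linear_combination -k.2 * ht
    have hk := h.mono_mem_adjoin_mono_mono (m := m) (n := n) (t * det₂ k n).val (t * det₂ m k).val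
    rwa [← Nat.cast_smul_eq_nsmul (ZMod d), ← Nat.cast_smul_eq_nsmul (ZMod d),
      ZMod.natCast_zmod_val, ZMod.natCast_zmod_val, ← hcramer] at hk

end IsSymbolPair

section ShuffleForms

variable (F : Type*) {A : Type*} [Field F] [Ring A] [Algebra F A]

/-- The linear form `v ↦ shuffle u p [v]`. -/
def shuffleLin (u : A) (p : ℕ) : A →ₗ[F] A where
  toFun v := shuffle u p [v]
  map_add' := shuffle_append_add u p [] []
  map_smul' := shuffle_append_smul u p [] []

/-- The bilinear form `(v, v') ↦ shuffle u p [v, v']`. -/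
def shuffleBilin (u : A) (p : ℕ) : A →ₗ[F] A →ₗ[F] A :=
  .mk₂ F (fun v v' => shuffle u p [v, v'])
    (fun v₁ v₂ v' => shuffle_append_add u p [] [v'] v₁ v₂)
    (fun c v v' => shuffle_append_smul u p [] [v'] c v)
    (fun v v₁ v₂ => shuffle_append_add u p [v] [] v₁ v₂)
    (fun c v v' => shuffle_append_smul u p [v] [] c v')

/-- The bilinear form sending `(v, v')` to the sum of all words with `p` letters `u`, one letter `t`
and one each of `v`, `v'`, in which `v` precedes `v'`. -/
def shuffleBilinInsert (u t : A) (p : ℕ) : A →ₗ[F] A →ₗ[F] A :=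
  .mk₂ F (fun v v' => shuffle u p [t, v, v'] + shuffle u p [v, t, v'] + shuffle u p [v, v', t])
    (fun v₁ v₂ v' => by
      have h₁ := shuffle_append_add u p [t] [v'] v₁ v₂
      have h₂ := shuffle_append_add u p [] [t, v'] v₁ v₂
      have h₃ := shuffle_append_add u p [] [v', t] v₁ v₂
      simp only [List.cons_append, List.nil_append] at h₁ h₂ h₃
      rw [h₁, h₂, h₃]
      abel)
    (fun c v v' => by
      rw [smul_add, smul_add]
      exact congr_arg₂ _ (congr_arg₂ _ (shuffle_append_smul u p [t] [v'] c v)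
        (shuffle_append_smul u p [] [t, v'] c v)) (shuffle_append_smul u p [] [v', t] c v))
    (fun v v₁ v₂ => by
      have h₁ := shuffle_append_add u p [t, v] [] v₁ v₂
      have h₂ := shuffle_append_add u p [v, t] [] v₁ v₂
      have h₃ := shuffle_append_add u p [v] [t] v₁ v₂
      simp only [List.cons_append, List.nil_append] at h₁ h₂ h₃
      rw [h₁, h₂, h₃]
      abel)
    (fun c v v' => by
      rw [smul_add, smul_add]
      exact congr_arg₂ _ (congr_arg₂ _ (shuffle_append_smul u p [t, v] [] c v')
        (shuffle_append_smul u p [v, t] [] c v')) (shuffle_append_smul u p [v] [t] c v'))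

end ShuffleForms

section Polarization

variable {F A : Type*} [Field F] [Ring A] [Algebra F A] {q : F} (hq : IsPrimitiveRoot q 5)
  {N V : Submodule F A} (hV : ∀ v ∈ V, v ^ 5 ∈ N) {u t v : A} (hu : u ∈ V) (hv : v ∈ V)

include hq hV hu hv

theorem shuffle_replicate_mem_of_forall_pow_mem {p k : ℕ} (hpk : p + k = 5) :
    shuffle u p (.replicate k v) ∈ N :=
  shuffle_replicate_mem hq (fun s => hV _ (V.add_mem (V.smul_mem s hu) hv)) hpk

theorem shuffleLin_mem : shuffleLin F u 4 v ∈ N :=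
  shuffle_replicate_mem_of_forall_pow_mem hq hV hu hv (k := 1) rfl

theorem shuffleBilin_mem : shuffleBilin F u 3 v v ∈ N :=
  shuffle_replicate_mem_of_forall_pow_mem hq hV hu hv (k := 2) rfl

theorem shuffleBilinInsert_mem (ht : t ∈ V) : shuffleBilinInsert F u t 2 v v ∈ N := by
  let T : ℕ → A
    | 0 => shuffle u 2 [v, v, v]
    | 1 => shuffleBilinInsert F u t 2 v v
    | 2 => shuffle u 2 [t, t, v] + shuffle u 2 [t, v, t] + shuffle u 2 [v, t, t]
    | 3 => shuffle u 2 [t, t, t]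
    | _ => 0
  refine mem_of_forall_root_sum_pow_smul_mem (T := T) hq (l := 1) (fun s _ => ?_) (by norm_num)
  have hs : shuffle u 2 [s • t + v, s • t + v, s • t + v] ∈ N :=
    shuffle_replicate_mem_of_forall_pow_mem hq hV hu (V.add_mem (V.smul_mem s ht) hv) (k := 3) rfl
  have h₁ (l l' : List A) : shuffle u 2 (l ++ (s • t + v) :: l') =
      s • shuffle u 2 (l ++ t :: l') + shuffle u 2 (l ++ v :: l') := by
    rw [shuffle_append_add, shuffle_append_smul]
  have h₂ := h₁ [] [s • t + v, s • t + v]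
  have h₃ (v₁ : A) := h₁ [v₁] [s • t + v]
  have h₄ (v₁ v₂ : A) := h₁ [v₁, v₂] []
  simp only [List.cons_append, List.nil_append] at h₂ h₃ h₄
  rw [h₂, h₃, h₃, h₄, h₄, h₄, h₄] at hs
  convert hs using 1
  simp only [sum_range_succ, sum_range_zero, T, shuffleBilinInsert, LinearMap.mk₂_apply]
  module

end Polarization

section ShuffleCoeff

variable {F : Type*} [Field F] {r s t : F}

theorem geom_sum_five_eq_zero (hr : r ^ 5 = 1) (hr₁ : r ≠ 1) :
    1 + r + r ^ 2 + r ^ 3 + r ^ 4 = 0 := by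
  refine (mul_eq_zero.1 ?_).resolve_left (sub_ne_zero.2 hr₁)
  linear_combination hr

theorem shuffleCoeff_four_singleton_one : shuffleCoeff 4 [(1 : F)] = 5 := by
  norm_num [shuffleCoeff]

theorem one_sub_mul_shuffleCoeff_three (hr : r ^ 5 = 1) (hr₁ : r ≠ 1) :
    (1 - r) * shuffleCoeff 3 [r, r⁻¹] = 5 := by
  have hr₀ : r ≠ 0 := by rintro rfl; norm_num at hr
  have hΦ := geom_sum_five_eq_zero hr hr₁
  simp only [shuffleCoeff, zero_add, Nat.reduceAdd]
  field_simp
  linear_combination -hΦ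

theorem one_sub_mul_one_sub_mul_shuffleCoeff_two (hr : r ^ 5 = 1) (hr₁ : r ≠ 1) (ht : t ^ 5 = 1)
    (ht₁ : t ≠ 1) (hs₁ : s ≠ 1) (hrst : r * s * t = 1) :
    (1 - r) * (1 - r * s) * shuffleCoeff 2 [r, s, t] = 5 := by
  obtain ⟨y, rfl⟩ : ∃ y, t = y⁻¹ := ⟨t⁻¹, (inv_inv t).symm⟩
  have hr₀ : r ≠ 0 := by rintro rfl; norm_num at hr
  have hy₀ : y ≠ 0 := by rintro rfl; norm_num at ht
  obtain rfl : s = r⁻¹ * y := by field_simp; field_simp at hrst; rw [← hrst]; ring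
  have hΦr := geom_sum_five_eq_zero hr hr₁
  have hΦy := geom_sum_five_eq_zero (r := y) (by simpa using ht) (by simpa using ht₁)
  have hry : r - y ≠ 0 := by
    refine sub_ne_zero.2 fun hry => hs₁ ?_
    rw [hry, inv_mul_cancel₀ hy₀]
  have hh : 1 + r + y + r ^ 2 + r * y + y ^ 2 + r ^ 3 + r ^ 2 * y + r * y ^ 2 + y ^ 3 = 0 := by
    refine (mul_eq_zero.1 ?_).resolve_left hry
    linear_combination hΦr - hΦy
  simp only [shuffleCoeff, zero_add, Nat.reduceAdd]
  field_simp
  linear_combination -hΦy - (1 - y) * hh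

theorem shuffleCoeff_two_add_cyclic (hr : r ^ 5 = 1) (hr₁ : r ≠ 1) (hs : s ^ 5 = 1) (hs₁ : s ≠ 1)
    (ht₁ : t ≠ 1) (hrst : r * s * t = 1) :
    shuffleCoeff 2 [r, s, t] + r * shuffleCoeff 2 [s, t, r] + r * s * shuffleCoeff 2 [t, r, s] =
      5 * (1 + r + r * s) := by
  have ht : t ^ 5 = 1 := calc
    t ^ 5 = (r * s * t) ^ 5 := by rw [mul_pow, mul_pow, hr, hs, one_mul, one_mul]
    _ = 1 := by rw [hrst, one_pow]
  have hrs₁ : r * s ≠ 1 := fun hrs => ht₁ (by rw [← hrst, hrs, one_mul])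
  have h₁ := one_sub_mul_one_sub_mul_shuffleCoeff_two hr hr₁ ht ht₁ hs₁ hrst
  have h₂ := one_sub_mul_one_sub_mul_shuffleCoeff_two hs hs₁ hr hr₁ ht₁ (by rw [← hrst]; ring)
  have h₃ := one_sub_mul_one_sub_mul_shuffleCoeff_two ht ht₁ hs hs₁ hr₁ (by rw [← hrst]; ring)
  have e₁ : r * (1 - s * t) = -(1 - r) := by linear_combination -hrst
  have e₂ : r * s * (1 - t) = -(1 - r * s) := by linear_combination -hrst
  have e₃ : s * (1 - t * r) = -(1 - s) := by linear_combination -hrst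
  refine mul_left_cancel₀ (mul_ne_zero (mul_ne_zero (sub_ne_zero.2 hr₁.symm)
    (sub_ne_zero.2 hs₁.symm)) (sub_ne_zero.2 hrs₁.symm)) ?_
  linear_combination (1 - s) * h₁ - r ^ 2 * (1 - r * s) * h₂ + r ^ 2 * s ^ 3 * (1 - r) * h₃ +
    r * (1 - s) * (1 - r * s) * shuffleCoeff 2 [s, t, r] * e₁ +
    r * s * (1 - r) * shuffleCoeff 2 [t, r, s] * ((1 - r * s) * e₃ - s * (1 - t * r) * e₂)

theorem shuffleCoeff_two_add_self (hr : r ^ 5 = 1) (hr₁ : r ≠ 1) :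
    shuffleCoeff 2 [r ^ 3, r, r] + r ^ 4 * shuffleCoeff 2 [r, r ^ 3, r] +
      r ^ 3 * shuffleCoeff 2 [r, r, r ^ 3] = 5 * (1 + r ^ 3 + r ^ 4) := by
  have hΦ := geom_sum_five_eq_zero hr hr₁
  simp only [shuffleCoeff, zero_add, Nat.reduceAdd]
  linear_combination 3 * hΦ + (7 + 3 * r + 3 * r ^ 2 + 6 * r ^ 3 + 5 * r ^ 4 + 3 * r ^ 5 + r ^ 7 +
    2 * r ^ 8 + r ^ 9) * hr

end ShuffleCoeff

namespace IsSymbolPair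

variable {F A : Type*} [Field F] [Ring A] [Algebra F A] {d : ℕ} [NeZero d] {q a b : F} {w z : A}
  (h : IsSymbolPair d q a b w z)

include h

theorem shuffle_mono (k : ZMod d × ZMod d) (p : ℕ) (l : List (ZMod d × ZMod d)) :
    shuffle (mono w z k) p (l.map (mono w z)) =
      shuffleCoeff p (l.map fun n => h.char (det₂ k n)) •
        (mono w z k ^ p * (l.map (mono w z)).prod) := by
  refine shuffle_eq_smul ?_ p
  rw [List.forall₂_map_left_iff, List.forall₂_map_right_iff, List.forall₂_same]
  exact fun n _ => h.mono_mul_comm n k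

theorem mono_pow_mul_prod_mono (k : ZMod d × ZMod d) (p : ℕ) (l : List (ZMod d × ZMod d)) :
    ∃ c : Fˣ, mono w z k ^ p * (l.map (mono w z)).prod = c • mono w z (p • k + l.sum) := by
  have hprod : ∃ c : Fˣ, (l.map (mono w z)).prod = c • mono w z l.sum := by
    induction l with
    | nil => exact ⟨1, by simp [mono]⟩
    | cons n l ih =>
      obtain ⟨c, hc⟩ := ih
      obtain ⟨c', hc'⟩ := h.mono_mul_mono n l.sum
      exact ⟨c * c', by rw [List.map_cons, List.prod_cons, hc, mul_smul_comm, hc', smul_smul,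
        List.sum_cons]⟩
  obtain ⟨c, hc⟩ := hprod
  obtain ⟨c', hc'⟩ := h.mono_pow k p
  obtain ⟨c'', hc''⟩ := h.mono_mul_mono (p • k) l.sum
  exact ⟨c' * c * c'', by rw [hc, hc', smul_mul_smul_comm, hc'', smul_smul]⟩

theorem shuffle_mono_eq_smul_mono (k : ZMod d × ZMod d) (p : ℕ) (l : List (ZMod d × ZMod d)) :
    ∃ c : F, shuffle (mono w z k) p (l.map (mono w z)) = c • mono w z (p • k + l.sum) := by
  obtain ⟨c, hc⟩ := h.mono_pow_mul_prod_mono k p l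
  exact ⟨_, by rw [h.shuffle_mono, hc, Units.smul_def, smul_smul]⟩

variable [Nontrivial A]

theorem repr_eq_zero_of_map_mem_center {L : A →ₗ[F] A} {s n : ZMod d × ZMod d}
    (hL : ∀ k, ∃ c : F, L (mono w z k) = c • mono w z (s + k)) (hn : L (mono w z n) ≠ 0)
    (hs : s + n ≠ 0) {v : A} (hv : L v ∈ Set.center A) : h.basis.repr v n = 0 := by
  choose c hc using hL
  have hrepr : h.basis.repr (L v) (s + n) = h.basis.repr v n * c n := by
    conv_lhs => rw [← h.sum_repr_smul_mono v]
    simp [hc, h.repr_mono, Finsupp.single_apply]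
  rw [h.repr_eq_zero_of_mem_center hv hs] at hrepr
  refine (mul_eq_zero.1 hrepr.symm).resolve_right fun hcn => hn ?_
  rw [hc, hcn, zero_smul]

theorem repr_mul_repr_eq_zero_of_map_mem_center {E : A →ₗ[F] A →ₗ[F] A}
    {s n n' : ZMod d × ZMod d}
    (hE : ∀ k k', ∃ c : F, E (mono w z k) (mono w z k') = c • mono w z (s + (k + k')))
    (hn : ∑ k ∈ {n, n'}, E (mono w z k) (mono w z (n + n' - k)) ≠ 0) (hs : s + (n + n') ≠ 0)
    {v : A} (hv : E v v ∈ Set.center A)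
    (hiso : ∀ k, h.basis.repr v k * h.basis.repr v (n + n' - k) ≠ 0 → k = n ∨ k = n') :
    h.basis.repr v n * h.basis.repr v n' = 0 := by
  choose c hc using hE
  have hrepr : h.basis.repr (E v v) (s + (n + n')) = ∑ k,
      (h.basis.repr v k * h.basis.repr v (n + n' - k)) * c k (n + n' - k) := by
    conv_lhs => rw [← h.sum_repr_smul_mono v]
    simp only [map_sum, LinearMap.sum_apply, map_smul, LinearMap.smul_apply, hc, smul_sum]
    rw [sum_comm]
    simp [h.repr_mono, Finsupp.single_apply, ← eq_sub_iff_add_eq', mul_assoc, mul_left_comm]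
  have hpair : ∑ k, (h.basis.repr v k * h.basis.repr v (n + n' - k)) * c k (n + n' - k) =
      h.basis.repr v n * h.basis.repr v n' * ∑ k ∈ {n, n'}, c k (n + n' - k) := by
    rw [mul_sum, ← sum_subset (subset_univ {n, n'})]
    · refine sum_congr rfl fun k hk => ?_
      rcases mem_insert.1 hk with rfl | hk
      · rw [add_sub_cancel_left]
      · rw [mem_singleton.1 hk, add_sub_cancel_right, mul_comm (h.basis.repr v n')]
    · intro k _ hk
      rw [not_imp_comm.1 (hiso k) (by simpa using hk), zero_mul]
  rw [h.repr_eq_zero_of_mem_center hv hs, hpair] at hrepr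
  refine (mul_eq_zero.1 hrepr.symm).resolve_right fun hcn => hn ?_
  rw [sum_congr rfl fun k _ => hc k (n + n' - k)]
  simp only [add_sub_cancel]
  rw [← sum_smul, hcn, zero_smul]

end IsSymbolPair

instance fact_prime_five : Fact (Nat.Prime 5) := ⟨Nat.prime_five⟩

section Exclusion

variable {F A : Type*} [Field F] [Ring A] [Algebra F A] {q a b : F} {w z : A}
  (h : IsSymbolPair 5 q a b w z) {k l n n' : ZMod 5 × ZMod 5}

namespace IsSymbolPair

include h

theorem five_ne_zero : (5 : F) ≠ 0 := by
  have := h.prim.neZero'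
  exact_mod_cast this.out

theorem char_pow_five (i : ZMod 5) : h.char i ^ 5 = 1 := by
  rw [← AddChar.map_nsmul_eq_pow, h.char_eq_one_iff, nsmul_eq_mul, Nat.cast_ofNat]
  exact zero_mul i

theorem char_ne_one {i : ZMod 5} (hi : i ≠ 0) : h.char i ≠ 1 :=
  fun hq => hi (h.char_eq_one_iff.1 hq)

variable [Nontrivial A]

theorem shuffleLin_mono_ne_zero (hkn : det₂ k n = 0) :
    shuffleLin F (mono w z k) 4 (mono w z n) ≠ 0 := by
  have hL := h.shuffle_mono k 4 [n]
  rw [List.map_singleton, List.map_singleton, hkn, AddChar.map_zero_eq_one,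
    shuffleCoeff_four_singleton_one, List.prod_singleton] at hL
  rw [shuffleLin, LinearMap.coe_mk, AddHom.coe_mk, hL]
  exact smul_ne_zero h.five_ne_zero (((h.isUnit_mono k).pow 4).mul (h.isUnit_mono n)).ne_zero

theorem shuffleBilin_mono_add_ne_zero (hkn : det₂ k n ≠ 0) {c : ZMod 5} (hc : c ≠ 1)
    (hsum : n + n' = c • k) :
    shuffleBilin F (mono w z k) 3 (mono w z n) (mono w z n') +
      shuffleBilin F (mono w z k) 3 (mono w z n') (mono w z n) ≠ 0 := by
  obtain rfl : n' = c • k - n := eq_sub_of_add_eq' hsum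
  have hkn' : det₂ k (c • k - n) = -det₂ k n := by
    simp only [det₂, Prod.fst_sub, Prod.snd_sub, Prod.smul_fst, Prod.smul_snd, smul_eq_mul]
    ring
  have hnn' : det₂ n (c • k - n) = -(c * det₂ k n) := by
    simp only [det₂, Prod.fst_sub, Prod.snd_sub, Prod.smul_fst, Prod.smul_snd, smul_eq_mul]
    ring
  have hE := h.shuffle_mono k 3 [n, c • k - n]
  have hE' := h.shuffle_mono k 3 [c • k - n, n]
  simp only [List.map_cons, List.map_nil, List.prod_cons, List.prod_nil, mul_one, hkn',
    h.mono_mul_comm (c • k - n) n, hnn', AddChar.map_neg_eq_inv, mul_smul_comm, smul_smul]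
    at hE hE'
  rw [shuffleBilin, LinearMap.mk₂_apply, LinearMap.mk₂_apply, hE, hE', ← add_smul]
  refine smul_ne_zero (fun hzero => hc ?_)
    (((h.isUnit_mono k).pow 3).mul ((h.isUnit_mono n).mul (h.isUnit_mono _))).ne_zero
  have hr := one_sub_mul_shuffleCoeff_three (h.char_pow_five _) (h.char_ne_one hkn)
  have hr' := one_sub_mul_shuffleCoeff_three (h.char_pow_five _) (h.char_ne_one (neg_ne_zero.2 hkn))
  rw [AddChar.map_neg_eq_inv, inv_inv] at hr'
  have hinv := mul_inv_cancel₀ (h.char_ne_zero (det₂ k n))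
  have hfactor : 5 * (1 - h.char (det₂ k n)) *
      ((h.char (c * det₂ k n))⁻¹ - (h.char (det₂ k n))⁻¹) = 0 := by
    linear_combination (1 - h.char (det₂ k n)) * (1 - (h.char (det₂ k n))⁻¹) * hzero -
      (1 - (h.char (det₂ k n))⁻¹) * hr - (1 - h.char (det₂ k n)) * (h.char (c * det₂ k n))⁻¹ * hr' +
      5 * hinv
  have hchar := (mul_eq_zero.1 hfactor).resolve_left
    (mul_ne_zero h.five_ne_zero (sub_ne_zero.2 (h.char_ne_one hkn).symm))
  exact mul_eq_right₀ hkn |>.1 (h.char_injective (inv_injective (sub_eq_zero.1 hchar)))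

omit [Nontrivial A] in
theorem shuffleBilinInsert_mono (hsum : k + l + n + n' = 0) :
    shuffleBilinInsert F (mono w z k) (mono w z l) 2 (mono w z n) (mono w z n') =
    (shuffleCoeff 2 [h.char (det₂ k l), h.char (det₂ k n), h.char (det₂ k n')] +
      h.char (det₂ l n) *
        shuffleCoeff 2 [h.char (det₂ k n), h.char (det₂ k l), h.char (det₂ k n')] +
      h.char (det₂ k l) *
        shuffleCoeff 2 [h.char (det₂ k n), h.char (det₂ k n'), h.char (det₂ k l)]) •
      (mono w z k ^ 2 * (mono w z l * (mono w z n * mono w z n'))) := by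
  have hnl : mono w z n * (mono w z l * mono w z n') =
      h.char (det₂ l n) • (mono w z l * (mono w z n * mono w z n')) := by
    rw [← mul_assoc, h.mono_mul_comm n l, smul_mul_assoc, mul_assoc]
  have hnn'l : mono w z n * (mono w z n' * mono w z l) =
      h.char (det₂ k l) • (mono w z l * (mono w z n * mono w z n')) := by
    rw [h.mono_mul_comm n' l, mul_smul_comm, hnl, smul_smul, ← AddChar.map_add_eq_mul]
    congr 2
    obtain rfl : n' = -(k + l + n) := eq_neg_of_add_eq_zero_right hsum
    simp only [det₂, Prod.fst_add, Prod.snd_add, Prod.fst_neg, Prod.snd_neg]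
    ring
  have h₁ := h.shuffle_mono k 2 [l, n, n']
  have h₂ := h.shuffle_mono k 2 [n, l, n']
  have h₃ := h.shuffle_mono k 2 [n, n', l]
  simp only [List.map_cons, List.map_nil, List.prod_cons, List.prod_nil, mul_one] at h₁ h₂ h₃
  rw [shuffleBilinInsert, LinearMap.mk₂_apply, h₁, h₂, h₃, hnl, hnn'l, mul_smul_comm, mul_smul_comm]
  module

omit [Nontrivial A] in
theorem shuffleBilinInsert_mono_add (hkl : det₂ k l ≠ 0) (hkn : det₂ k n ≠ 0)
    (hkn' : det₂ k n' ≠ 0) (hsum : k + l + n + n' = 0) :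
    shuffleBilinInsert F (mono w z k) (mono w z l) 2 (mono w z n) (mono w z n') +
      shuffleBilinInsert F (mono w z k) (mono w z l) 2 (mono w z n') (mono w z n) =
    (5 * (1 + h.char (det₂ k l) + h.char (det₂ k l) * h.char (det₂ k n) +
      h.char (det₂ l n) * (1 + h.char (det₂ k n) + h.char (det₂ k l) * h.char (det₂ k n)))) •
      (mono w z k ^ 2 * (mono w z l * (mono w z n * mono w z n'))) := by
  have hn' : n' = -(k + l + n) := eq_neg_of_add_eq_zero_right hsum
  have hkln : det₂ k l + det₂ k n + det₂ k n' = 0 := by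
    rw [hn']
    simp only [det₂, Prod.fst_add, Prod.snd_add, Prod.fst_neg, Prod.snd_neg]
    ring
  have hln : det₂ l n + det₂ l n' = det₂ k l := by
    rw [hn']
    simp only [det₂, Prod.fst_add, Prod.snd_add, Prod.fst_neg, Prod.snd_neg]
    ring
  have hnn' : det₂ n n' = det₂ k n + det₂ l n := by
    rw [hn']
    simp only [det₂, Prod.fst_add, Prod.snd_add, Prod.fst_neg, Prod.snd_neg]
    ring
  have hABC := congr_arg h.char hkln
  rw [AddChar.map_add_eq_mul, AddChar.map_add_eq_mul, AddChar.map_zero_eq_one] at hABC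
  have hcyc := shuffleCoeff_two_add_cyclic (h.char_pow_five _) (h.char_ne_one hkl)
    (h.char_pow_five _) (h.char_ne_one hkn) (h.char_ne_one hkn') hABC
  have hcyc' := shuffleCoeff_two_add_cyclic (h.char_pow_five _) (h.char_ne_one hkn)
    (h.char_pow_five _) (h.char_ne_one hkl) (h.char_ne_one hkn') (by rw [← hABC]; ring)
  have hκ := congr_arg h.char hln
  rw [AddChar.map_add_eq_mul] at hκ
  rw [h.shuffleBilinInsert_mono hsum, h.shuffleBilinInsert_mono (by rw [← hsum]; abel),
    h.mono_mul_comm n' n, hnn', AddChar.map_add_eq_mul, mul_smul_comm, mul_smul_comm, smul_smul,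
    ← add_smul]
  congr 1
  linear_combination hcyc + h.char (det₂ l n) * hcyc' + h.char (det₂ k n) *
    shuffleCoeff 2 [h.char (det₂ k n'), h.char (det₂ k l), h.char (det₂ k n)] * hκ

theorem shuffleBilinInsert_mono_self_ne_zero (hkl : det₂ k l ≠ 0) (hsum : k + l + n + n = 0) :
    shuffleBilinInsert F (mono w z k) (mono w z l) 2 (mono w z n) (mono w z n) ≠ 0 := by
  have h5 : (5 : ZMod 5) = 0 := rfl
  obtain rfl : l = -(k + n + n) := by rw [eq_neg_iff_add_eq_zero, ← hsum]; abel
  have hkl' : det₂ k (-(k + n + n)) = 3 • det₂ k n := by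
    simp only [det₂, Prod.fst_add, Prod.snd_add, Prod.fst_neg, Prod.snd_neg]
    linear_combination (k.2 * n.1 - k.1 * n.2) * h5
  have hln : det₂ (-(k + n + n)) n = 4 • det₂ k n := by
    simp only [det₂, Prod.fst_add, Prod.snd_add, Prod.fst_neg, Prod.snd_neg]
    linear_combination (k.2 * n.1 - k.1 * n.2) * h5
  have hkn : det₂ k n ≠ 0 := fun hkn => hkl (by rw [hkl', hkn, smul_zero])
  have hB := h.char_pow_five (det₂ k n)
  have hB₁ := h.char_ne_one hkn
  rw [h.shuffleBilinInsert_mono hsum, hkl', hln, AddChar.map_nsmul_eq_pow,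
    AddChar.map_nsmul_eq_pow, shuffleCoeff_two_add_self hB hB₁]
  refine smul_ne_zero (mul_ne_zero h.five_ne_zero fun hzero => hB₁ ?_)
    (((h.isUnit_mono k).pow 2).mul
      ((h.isUnit_mono _).mul ((h.isUnit_mono n).mul (h.isUnit_mono n)))).ne_zero
  have hB₃ : h.char (det₂ k n) ^ 3 = 1 := by
    linear_combination (h.char (det₂ k n) - 1) * h.char (det₂ k n) ^ 2 * hzero -
      (h.char (det₂ k n) ^ 2 - 1) * hB
  linear_combination (h.char (det₂ k n) ^ 3 + 1) * hB₃ - h.char (det₂ k n) * hB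

theorem shuffleBilinInsert_mono_add_ne_zero {i j : ℕ} (hkl : det₂ k l ≠ 0)
    (hkn : det₂ k n = i * det₂ k l) (hln : det₂ l n = j * det₂ k l) (hsum : k + l + n + n' = 0)
    (hi : (i : ZMod 5) ≠ 0) (hi' : (i + 1 : ZMod 5) ≠ 0)
    (hq : ∀ r : F, r ^ 5 = 1 → r ≠ 1 → 1 + r + r * r ^ i + r ^ j * (1 + r ^ i + r * r ^ i) ≠ 0) :
    shuffleBilinInsert F (mono w z k) (mono w z l) 2 (mono w z n) (mono w z n') +
      shuffleBilinInsert F (mono w z k) (mono w z l) 2 (mono w z n') (mono w z n) ≠ 0 := by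
  have hkn' : det₂ k n' = -((i + 1) * det₂ k l) := by
    obtain rfl : n' = -(k + l + n) := eq_neg_of_add_eq_zero_right hsum
    simp only [det₂, Prod.fst_add, Prod.snd_add, Prod.fst_neg, Prod.snd_neg] at hkn ⊢
    linear_combination -hkn
  rw [h.shuffleBilinInsert_mono_add hkl (hkn ▸ mul_ne_zero hi hkl)
    (hkn' ▸ neg_ne_zero.2 (mul_ne_zero hi' hkl)) hsum, hkn, hln, ← nsmul_eq_mul, ← nsmul_eq_mul,
    AddChar.map_nsmul_eq_pow, AddChar.map_nsmul_eq_pow]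
  exact smul_ne_zero
    (mul_ne_zero h.five_ne_zero (hq _ (h.char_pow_five _) (h.char_ne_one hkl)))
    (((h.isUnit_mono k).pow 2).mul
      ((h.isUnit_mono l).mul ((h.isUnit_mono n).mul (h.isUnit_mono n')))).ne_zero

theorem shuffleBilinInsert_mono_add_ne_zero_of_det_eq_two_mul (hkl : det₂ k l ≠ 0)
    (hkn : det₂ k n = 2 * det₂ k l) (hln : det₂ l n = 4 * det₂ k l) (hsum : k + l + n + n' = 0) :
    shuffleBilinInsert F (mono w z k) (mono w z l) 2 (mono w z n) (mono w z n') +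
      shuffleBilinInsert F (mono w z k) (mono w z l) 2 (mono w z n') (mono w z n) ≠ 0 := by
  refine h.shuffleBilinInsert_mono_add_ne_zero (i := 2) (j := 4) hkl hkn hln hsum (by decide)
    (by decide) fun r hr hr₁ hzero => hr₁ ?_
  have hr₀ : r = 0 := by
    linear_combination hzero - geom_sum_five_eq_zero hr hr₁ - (r + r ^ 2) * hr
  rw [hr₀, zero_pow (by norm_num)] at hr
  exact hr₀.trans hr

theorem shuffleBilinInsert_mono_add_ne_zero_of_det_eq_three_mul (hkl : det₂ k l ≠ 0)
    (hkn : det₂ k n = 3 * det₂ k l) (hln : det₂ l n = 2 * det₂ k l) (hsum : k + l + n + n' = 0) :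
    shuffleBilinInsert F (mono w z k) (mono w z l) 2 (mono w z n) (mono w z n') +
      shuffleBilinInsert F (mono w z k) (mono w z l) 2 (mono w z n') (mono w z n) ≠ 0 := by
  refine h.shuffleBilinInsert_mono_add_ne_zero (i := 3) (j := 2) hkl hkn hln hsum (by decide)
    (by decide) fun r hr hr₁ hzero => hr₁ ?_
  have hr₂ : r ^ 2 * (1 + r) ^ 2 = 0 := by
    linear_combination 2 * geom_sum_five_eq_zero hr hr₁ - hzero + (1 + r) * hr
  have hr₀ : r ≠ 0 := by rintro rfl; norm_num at hr
  have hr' := pow_eq_zero_iff two_ne_zero |>.1 <|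
    (mul_eq_zero.1 hr₂).resolve_left (pow_ne_zero 2 hr₀)
  linear_combination hr - r * (r ^ 2 + 1) * (r - 1) * hr'

end IsSymbolPair

end Exclusion

/-- If the forms obtained by polarizing `v ↦ v ^ 5` are central on a space containing the monomials
with exponents in `P`, one of them is a multiple of the product of the coefficients at `n` and `n'`,
up to terms involving other pairs of exponents with the same sum. -/
def IsDetected (P : List (ZMod 5 × ZMod 5)) (n n' : ZMod 5 × ZMod 5) : Prop :=
  n ≠ n' ∧ (∃ k ∈ P, det₂ k n ≠ 0 ∧ ∃ c : ZMod 5, c ≠ 1 ∧ c ≠ 2 ∧ n + n' = c • k) ∨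
  ∃ k ∈ P, ∃ l ∈ P, det₂ k l ≠ 0 ∧ k + l + n + n' = 0 ∧
    (n = n' ∨ n ≠ n' ∧ (det₂ k n = 2 * det₂ k l ∧ det₂ l n = 4 * det₂ k l ∨
      det₂ k n = 3 * det₂ k l ∧ det₂ l n = 2 * det₂ k l))

instance (P : List (ZMod 5 × ZMod 5)) : DecidableRel (IsDetected P) := fun n n' => by
  unfold IsDetected; infer_instance

/-- The exponents `n` excluded by a linear form: no element of a `5`-central space containing the
monomials with exponents in `P` has a term with exponent `n`. -/
def IsLinearlyExcluded (P : List (ZMod 5 × ZMod 5)) (n : ZMod 5 × ZMod 5) : Prop :=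
  (∃ k ∈ P, det₂ k n = 0 ∧ n ≠ k) ∨ ∃ l ∈ P, n ≠ l ∧ IsDetected P n l

instance (P : List (ZMod 5 × ZMod 5)) : DecidablePred (IsLinearlyExcluded P) := fun n => by
  unfold IsLinearlyExcluded; infer_instance

/-- The exponents `n` excluded by a linear form or by a quadratic form which, once the linearly
excluded exponents are discarded, reduces to the square of the coefficient at `n`. -/
def IsExcluded (P : List (ZMod 5 × ZMod 5)) (n : ZMod 5 × ZMod 5) : Prop :=
  IsLinearlyExcluded P n ∨
    IsDetected P n n ∧ ∀ m, m = n ∨ IsLinearlyExcluded P m ∨ IsLinearlyExcluded P (n + n - m)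

instance (P : List (ZMod 5 × ZMod 5)) : DecidablePred (IsExcluded P) := fun n => by
  unfold IsExcluded; infer_instance

/-- The pairs of exponents excluded by a quadratic form which, once the excluded exponents are
discarded, reduces to the product of the coefficients at `n` and `n'`. -/
def IsPairExcluded (P : List (ZMod 5 × ZMod 5)) (n n' : ZMod 5 × ZMod 5) : Prop :=
  IsDetected P n n' ∧ ∀ m, m = n ∨ m = n' ∨ IsExcluded P m ∨ IsExcluded P (n + n' - m)

instance (P : List (ZMod 5 × ZMod 5)) : DecidableRel (IsPairExcluded P) := fun n n' => by
  unfold IsPairExcluded; infer_instance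

namespace IsSymbolPair

variable {F A : Type*} [Field F] [Ring A] [Algebra F A] {q a b : F} {w z : A}
  (h : IsSymbolPair 5 q a b w z) {k l n n' : ZMod 5 × ZMod 5} {V : Submodule F A}
  (hV : ∀ v ∈ V, v ^ 5 ∈ Set.center A) {v : A} (hv : v ∈ V)

include h

theorem shuffleBilin_mono_eq_smul_mono (k n n' : ZMod 5 × ZMod 5) :
    ∃ c : F, shuffleBilin F (mono w z k) 3 (mono w z n) (mono w z n') =
      c • mono w z (3 • k + (n + n')) := by
  simpa [shuffleBilin] using h.shuffle_mono_eq_smul_mono k 3 [n, n']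

theorem shuffleBilinInsert_mono_eq_smul_mono (k l n n' : ZMod 5 × ZMod 5) :
    ∃ c : F, shuffleBilinInsert F (mono w z k) (mono w z l) 2 (mono w z n) (mono w z n') =
      c • mono w z (2 • k + l + (n + n')) := by
  obtain ⟨c₁, h₁⟩ := h.shuffle_mono_eq_smul_mono k 2 [l, n, n']
  obtain ⟨c₂, h₂⟩ := h.shuffle_mono_eq_smul_mono k 2 [n, l, n']
  obtain ⟨c₃, h₃⟩ := h.shuffle_mono_eq_smul_mono k 2 [n, n', l]
  simp only [List.map_cons, List.map_nil, List.sum_cons, List.sum_nil, add_zero,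
    add_left_comm n l, add_comm n' l, ← add_assoc (2 • k) l] at h₁ h₂ h₃
  exact ⟨c₁ + c₂ + c₃, by
    rw [shuffleBilinInsert, LinearMap.mk₂_apply, h₁, h₂, h₃, add_smul, add_smul]⟩

variable [Nontrivial A] {P : List (ZMod 5 × ZMod 5)} (hP : ∀ k ∈ P, mono w z k ∈ V)

include hV hP

theorem exists_form_of_isDetected (hnn' : IsDetected P n n') :
    ∃ (E : A →ₗ[F] A →ₗ[F] A) (s : ZMod 5 × ZMod 5),
      (∀ k k', ∃ c : F, E (mono w z k) (mono w z k') = c • mono w z (s + (k + k'))) ∧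
      (∀ v ∈ V, E v v ∈ Set.center A) ∧
      ∑ k ∈ {n, n'}, E (mono w z k) (mono w z (n + n' - k)) ≠ 0 ∧ s + (n + n') ≠ 0 := by
  have hsum (E : A →ₗ[F] A →ₗ[F] A) (hne : n ≠ n') :
      ∑ k ∈ {n, n'}, E (mono w z k) (mono w z (n + n' - k)) =
        E (mono w z n) (mono w z n') + E (mono w z n') (mono w z n) := by
    rw [sum_pair hne, add_sub_cancel_left, add_sub_cancel_right]
  rcases hnn' with ⟨hne, k, hk, hkn, c, hc₁, hc₂, hc⟩ | ⟨k, hk, l, hl, hkl, hzero, hcase⟩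
  · refine ⟨shuffleBilin F (mono w z k) 3, 3 • k, h.shuffleBilin_mono_eq_smul_mono k, fun v hv =>
      shuffleBilin_mem h.prim (N := (Subalgebra.center F A).toSubmodule) hV (hP k hk) hv, ?_, ?_⟩
    · rw [hsum _ hne]
      exact h.shuffleBilin_mono_add_ne_zero hkn hc₁ hc
    · rw [hc, ← Nat.cast_smul_eq_nsmul (ZMod 5), ← add_smul]
      have hk₀ : k ≠ 0 := by
        rintro rfl
        simp [det₂] at hkn
      refine smul_ne_zero (fun hzero => hc₂ ?_) hk₀
      have h5 : (5 : ZMod 5) = 0 := rfl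
      linear_combination hzero - h5
  · refine ⟨shuffleBilinInsert F (mono w z k) (mono w z l) 2, 2 • k + l,
      h.shuffleBilinInsert_mono_eq_smul_mono k l, fun v hv => shuffleBilinInsert_mem h.prim
        (N := (Subalgebra.center F A).toSubmodule) hV (hP k hk) hv (hP l hl), ?_, ?_⟩
    · rcases hcase with rfl | ⟨hne, ⟨hkn, hln⟩ | ⟨hkn, hln⟩⟩
      · simpa using h.shuffleBilinInsert_mono_self_ne_zero hkl hzero
      · rw [hsum _ hne]
        exact h.shuffleBilinInsert_mono_add_ne_zero_of_det_eq_two_mul hkl hkn hln hzero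
      · rw [hsum _ hne]
        exact h.shuffleBilinInsert_mono_add_ne_zero_of_det_eq_three_mul hkl hkn hln hzero
    · have hindex : 2 • k + l + (n + n') = k + (k + l + n + n') := by abel
      rw [hindex, hzero, add_zero]
      rintro rfl
      simp [det₂] at hkl

include hv

theorem repr_mul_repr_eq_zero_of_isDetected (hnn' : IsDetected P n n')
    (hiso : ∀ k, h.basis.repr v k * h.basis.repr v (n + n' - k) ≠ 0 → k = n ∨ k = n') :
    h.basis.repr v n * h.basis.repr v n' = 0 := by
  obtain ⟨E, s, hE, hEV, hn, hs⟩ := h.exists_form_of_isDetected hV hP hnn'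
  exact h.repr_mul_repr_eq_zero_of_map_mem_center hE hn hs (hEV v hv) hiso

theorem repr_eq_zero_of_isDetected (hl : l ∈ P) (hnl : n ≠ l) (hdet : IsDetected P n l) :
    h.basis.repr v n = 0 := by
  obtain ⟨E, s, hE, hEV, hn, hs⟩ := h.exists_form_of_isDetected hV hP hdet
  rw [sum_pair hnl, add_sub_cancel_left, add_sub_cancel_right] at hn
  refine h.repr_eq_zero_of_map_mem_center (L := E.flip (mono w z l) + E (mono w z l))
    (s := s + l) (fun k => ?_) hn (by rwa [add_assoc, add_comm l]) ?_
  · obtain ⟨c, hc⟩ := hE k l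
    obtain ⟨c', hc'⟩ := hE l k
    exact ⟨c + c', by rw [LinearMap.add_apply, LinearMap.flip_apply, hc, hc', add_comm k, add_smul,
      add_assoc]⟩
  · have hadd : E (v + mono w z l) (v + mono w z l) - E v v - E (mono w z l) (mono w z l) ∈
        Subalgebra.center F A :=
      sub_mem (sub_mem (hEV _ (V.add_mem hv (hP l hl))) (hEV v hv)) (hEV _ (hP l hl))
    change _ ∈ Subalgebra.center F A
    convert hadd using 1
    simp only [LinearMap.add_apply, LinearMap.flip_apply, map_add]
    abel

theorem repr_eq_zero_of_isLinearlyExcluded (hn : IsLinearlyExcluded P n) :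
    h.basis.repr v n = 0 := by
  rcases hn with ⟨k, hk, hkn, hne⟩ | ⟨l, hl, hnl, hdet⟩
  · refine h.repr_eq_zero_of_map_mem_center (L := shuffleLin F (mono w z k) 4) (s := 4 • k)
      (fun n => by simpa [shuffleLin] using h.shuffle_mono_eq_smul_mono k 4 [n])
      (h.shuffleLin_mono_ne_zero hkn) (fun hzero => hne ?_)
      (shuffleLin_mem h.prim (N := (Subalgebra.center F A).toSubmodule) hV (hP k hk) hv)
    linear_combination (exp := 1) hzero - ZModModule.char_nsmul_eq_zero 5 k
  · exact h.repr_eq_zero_of_isDetected hV hv hP hl hnl hdet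

theorem repr_eq_zero_of_isExcluded (hn : IsExcluded P n) : h.basis.repr v n = 0 := by
  rcases hn with hn | ⟨hdet, hiso⟩
  · exact h.repr_eq_zero_of_isLinearlyExcluded hV hv hP hn
  · refine mul_self_eq_zero.1
      (h.repr_mul_repr_eq_zero_of_isDetected hV hv hP hdet fun k hk => .inl ?_)
    rcases hiso k with hkn | hex | hex
    · exact hkn
    · exact absurd (h.repr_eq_zero_of_isLinearlyExcluded hV hv hP hex) (left_ne_zero_of_mul hk)
    · exact absurd (h.repr_eq_zero_of_isLinearlyExcluded hV hv hP hex) (right_ne_zero_of_mul hk)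

theorem repr_mul_repr_eq_zero_of_isPairExcluded (hnn' : IsPairExcluded P n n') :
    h.basis.repr v n * h.basis.repr v n' = 0 := by
  refine h.repr_mul_repr_eq_zero_of_isDetected hV hv hP hnn'.1 fun k hk => ?_
  rcases hnn'.2 k with hkn | hkn' | hex | hex
  · exact .inl hkn
  · exact .inr hkn'
  · exact absurd (h.repr_eq_zero_of_isExcluded hV hv hP hex) (left_ne_zero_of_mul hk)
  · exact absurd (h.repr_eq_zero_of_isExcluded hV hv hP hex) (right_ne_zero_of_mul hk)

end IsSymbolPair

/-- The exponents of the monomials occurring in the standard spaces `F[x] y + F x` and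
`F[y] x + F y`, and in the sum of the standard spaces `F[x ^ 3 * y ^ 2] x + F (x ^ 3 * y ^ 2) ^ i`,
respectively. -/
def IsStandardExponent : Fin 3 → ZMod 5 × ZMod 5 → Prop
  | 0, n => n.2 = 1 ∨ n = (1, 0)
  | 1, n => n.1 = 1 ∨ n = (0, 1)
  | 2, n => n.1 + n.2 = 1 ∨ n.1 + n.2 = 0 ∧ n ≠ 0

instance (t : Fin 3) (n : ZMod 5 × ZMod 5) : Decidable (IsStandardExponent t n) := by
  unfold IsStandardExponent
  split <;> infer_instance

theorem isExcluded_or_exists_isStandardExponent : ∀ m : ZMod 5 × ZMod 5, m ≠ (1, 0) → m ≠ (0, 1) →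
    (∃ p ∈ [(1, 0), (0, 1), m], IsExcluded [(1, 0), (0, 1), m] p) ∨
    ∃ t t', ∀ n n', IsStandardExponent t n ∨ IsExcluded [(1, 0), (0, 1), m] n ∨
      IsStandardExponent t' n' ∨ IsExcluded [(1, 0), (0, 1), m] n' ∨
      IsPairExcluded [(1, 0), (0, 1), m] n n' ∨ IsPairExcluded [(1, 0), (0, 1), m] n' n := by
  decide +kernel

theorem forall_eq_zero_or_of_forall_mul_eq_zero {F E : Type*} [Field F] [AddCommGroup E]
    [Module F E] {V : Submodule F E} {f g : E →ₗ[F] F} (hfg : ∀ v ∈ V, f v * g v = 0) :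
    (∀ v ∈ V, f v = 0) ∨ ∀ v ∈ V, g v = 0 := by
  by_contra! hne
  obtain ⟨⟨u, hu, hfu⟩, v, hv, hgv⟩ := hne
  have hgu := (mul_eq_zero.1 (hfg u hu)).resolve_left hfu
  have hfv := (mul_eq_zero.1 (hfg v hv)).resolve_right hgv
  have huv := hfg (u + v) (V.add_mem hu hv)
  rw [map_add, map_add, hgu, hfv, add_zero, zero_add] at huv
  exact mul_ne_zero hfu hgv huv

theorem IsSymbolPair.exists_forall_isStandardExponent {F A : Type*} [Field F] [Ring A]
    [Nontrivial A] [Algebra F A] {q a b : F} {w z : A} (h : IsSymbolPair 5 q a b w z)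
    {V : Submodule F A} (hV : ∀ v ∈ V, v ^ 5 ∈ Set.center A) {m : ZMod 5 × ZMod 5}
    (hm₁ : m ≠ (1, 0)) (hm₂ : m ≠ (0, 1))
    (hP : ∀ k ∈ [(1, 0), (0, 1), m], mono w z k ∈ V) :
    ∃ t, ∀ v ∈ V, ∀ n, h.basis.repr v n ≠ 0 → IsStandardExponent t n := by
  rcases isExcluded_or_exists_isStandardExponent m hm₁ hm₂ with ⟨p, hp, hex⟩ | ⟨t, t', ht⟩
  · have hrepr := h.repr_eq_zero_of_isExcluded hV (hP p hp) hP hex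
    simp [h.repr_mono] at hrepr
  by_contra! hne
  obtain ⟨v, hv, n, hvn, hn⟩ := hne t
  obtain ⟨v', hv', n', hvn', hn'⟩ := hne t'
  have hmul : ∀ u ∈ V, h.basis.coord n u * h.basis.coord n' u = 0 := fun u hu => by
    simp only [Basis.coord_apply]
    rcases ht n n' with hstd | hex | hstd | hex | hex | hex
    · exact absurd hstd hn
    · exact absurd (h.repr_eq_zero_of_isExcluded hV hv hP hex) hvn
    · exact absurd hstd hn'
    · exact absurd (h.repr_eq_zero_of_isExcluded hV hv' hP hex) hvn'
    · exact h.repr_mul_repr_eq_zero_of_isPairExcluded hV hu hP hex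
    · rw [mul_comm]
      exact h.repr_mul_repr_eq_zero_of_isPairExcluded hV hu hP hex
  rcases forall_eq_zero_or_of_forall_mul_eq_zero hmul with hn₀ | hn₀
  · exact hvn (hn₀ v hv)
  · exact hvn' (hn₀ v' hv')

section PowAdd

theorem prod_one_sub_pow_mul_shuffleCoeff_replicate {R : Type*} [CommRing R] (r : R) (p k : ℕ) :
    (∏ i ∈ range k, (1 - r ^ (i + 1))) * shuffleCoeff p (.replicate k r) =
      ∏ i ∈ range k, (1 - r ^ (p + i + 1)) := by
  induction p generalizing k with
  | zero => simp [shuffleCoeff]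
  | succ p ihp =>
    induction k with
    | zero => simp [shuffleCoeff]
    | succ k ihk =>
      have ihp' := ihp (k + 1)
      rw [prod_range_succ, prod_range_succ'] at ihp'
      simp only [add_right_comm p 1, ← add_assoc p _ 1] at ihk ihp' ⊢
      rw [List.replicate_succ, shuffleCoeff, ← List.replicate_succ, prod_range_succ,
        prod_range_succ]
      linear_combination ihp' + r ^ (p + 1) * (1 - r ^ (k + 1)) * ihk

variable {F A : Type*} [Field F] [Ring A] [Algebra F A] {d : ℕ} {r : F} (hr : IsPrimitiveRoot r d)
  {u v t : A}

include hr

theorem add_pow_eq_add_pow_of_mul_eq_smul [NeZero d] (huv : v * u = r • (u * v)) :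
    (u + v) ^ d = u ^ d + v ^ d := by
  have hmid {p k : ℕ} (hpk : p + 1 + (k + 1) = d) :
      shuffle u (p + 1) (.replicate (k + 1) v) = 0 := by
    have hcoeff := prod_one_sub_pow_mul_shuffleCoeff_replicate r (p + 1) (k + 1)
    rw [prod_range_succ (fun i => 1 - r ^ (p + 1 + i + 1)), add_assoc, hpk, hr.pow_eq_one, sub_self,
      mul_zero] at hcoeff
    have hprod : ∏ i ∈ range (k + 1), (1 - r ^ (i + 1)) ≠ 0 := prod_ne_zero_iff.2 fun i hi =>
      sub_ne_zero.2 (hr.pow_ne_one_of_pos_of_lt i.succ_ne_zero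
        (by have := mem_range.1 hi; lia)).symm
    have hrep : List.Forall₂ (fun v r => v * u = r • (u * v)) (.replicate (k + 1) v)
        (.replicate (k + 1) r) := by
      simp [List.forall₂_iff_get, huv]
    rw [shuffle_eq_smul hrep, (mul_eq_zero.1 hcoeff).resolve_left hprod, zero_smul]
  rw [add_pow_eq_sum_shuffle, ← sum_subset (s₁ := {(d, 0), (0, d)}) (by simp [insert_subset_iff]),
    sum_pair (by simp [NeZero.ne d])]
  · simp
  · rintro ⟨- | p, - | k⟩ hpk hne
    · simp_all
    · simp_all
    · simp_all
    · exact hmid (mem_antidiagonal.1 hpk)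

theorem pow_eq_zero_of_forall_root_smul_add_pow_eq {k : ℕ} (hk : k ≠ 0) (hkd : k < d)
    (h : ∀ s : F, s ^ d = 1 → (s • u + v) ^ k = t) : u ^ k = 0 := by
  let T (l : ℕ) : A := (if l ∈ range (k + 1) then shuffle u l (.replicate (k - l) v) else 0) -
    if l = 0 then t else 0
  have hT := mem_of_forall_root_sum_pow_smul_mem (N := (⊥ : Submodule F A)) (T := T) hr
    (fun s hs => ?_) hkd
  · simpa [T, hk] using hT
  · have hs := h s hs
    simp only [add_pow_eq_sum_shuffle, Nat.sum_antidiagonal_eq_sum_range_succ_mk,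
      shuffle_smul_left] at hs
    have hsub : range (k + 1) ⊆ range d := range_mono hkd
    simp only [T, smul_sub, sum_sub_distrib, smul_ite, smul_zero]
    rw [← sum_filter, filter_mem_eq_inter, inter_eq_right.2 hsub, hs]
    simp [hkd.pos]

theorem eq_pow_add_pow_of_forall_root_smul_add_pow_eq [NeZero d]
    (h : ∀ s : F, s ^ d = 1 → (s • u + v) ^ d = t) : t = u ^ d + v ^ d := by
  let T (l : ℕ) : A := shuffle u l (.replicate (d - l) v) - if l = 0 then t - u ^ d else 0
  have hT := mem_of_forall_root_sum_pow_smul_mem (N := (⊥ : Submodule F A)) (T := T) hr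
    (fun s hs => ?_) (NeZero.pos d)
  · simp only [T, shuffle_zero, tsub_zero, List.prod_replicate, if_pos, Submodule.mem_bot] at hT
    rw [sub_eq_zero] at hT
    rw [hT, add_sub_cancel]
  · have hs' := h s hs
    simp only [add_pow_eq_sum_shuffle, Nat.sum_antidiagonal_eq_sum_range_succ_mk,
      shuffle_smul_left] at hs'
    rw [sum_range_succ, hs, one_smul, Nat.sub_self, List.replicate_zero, shuffle_nil,
      ← eq_sub_iff_add_eq] at hs'
    simp only [T, smul_sub, sum_sub_distrib, smul_ite, smul_zero, hs']
    simp [NeZero.pos d]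

end PowAdd

section CoeffPoly

open Polynomial

theorem prod_comp_C_pow_mul_X_comp {R : Type*} [CommRing R] (r : R) (p : R[X]) (k : ℕ) :
    (∏ i ∈ range k, p.comp (C (r ^ i) * X)).comp (C r * X) =
      ∏ i ∈ range k, p.comp (C (r ^ (i + 1)) * X) := by
  simp only [Polynomial.prod_comp, comp_assoc, mul_comp, C_comp, X_comp, ← mul_assoc, ← C_mul,
    ← pow_succ]

namespace IsSymbolPair

variable {F A : Type*} [Field F] [Ring A] [Algebra F A] {d : ℕ} {q a b : F} {w z : A}
  (h : IsSymbolPair d q a b w z)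

include h

theorem right_mul_aeval (p : F[X]) : z * aeval w p = aeval w (p.comp (C q * X)) * z := by
  have hz : SemiconjBy z w (q • w) := by rw [SemiconjBy, h.right_mul_left, smul_mul_assoc]
  induction p using Polynomial.induction_on' with
  | add p r hp hr => rw [map_add, mul_add, hp, hr, add_comp, map_add, add_mul]
  | monomial k c =>
    rw [← C_mul_X_pow_eq_monomial, mul_comp, C_comp, X_pow_comp]
    simp only [map_mul, map_pow, aeval_C, aeval_X]
    rw [← mul_assoc, ← Algebra.commutes, mul_assoc, mul_assoc, ← Algebra.smul_def q,
      (hz.pow_right k).eq]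

theorem aeval_mul_right_pow (p : F[X]) (k : ℕ) : (aeval w p * z) ^ k =
    aeval w (∏ i ∈ range k, p.comp (C (q ^ i) * X)) * z ^ k := by
  induction k with
  | zero => simp
  | succ k ih =>
    rw [pow_succ', ih, mul_assoc, ← mul_assoc z, h.right_mul_aeval, prod_comp_C_pow_mul_X_comp,
      mul_assoc, ← pow_succ', ← mul_assoc, ← map_mul, prod_range_succ', pow_zero, C_1, one_mul,
      comp_X, mul_comm]

theorem aeval_mul_right_pow_mem_center (p : F[X]) : (aeval w p * z) ^ d ∈ Set.center A := by
  have hshift : ∏ i ∈ range d, p.comp (C (q ^ (i + 1)) * X) =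
      ∏ i ∈ range d, p.comp (C (q ^ i) * X) := by
    rcases d with - | d
    · simp
    · rw [prod_range_succ, prod_range_succ', h.prim.pow_eq_one, pow_zero]
  rw [h.aeval_mul_right_pow, h.right_pow, ← Algebra.commutes, ← Algebra.smul_def]
  refine Set.smul_mem_center _ (h.mem_center_of_commute ?_ ?_)
  · simpa only [aeval_X] using (Commute.all X (∏ i ∈ range d, p.comp (C (q ^ i) * X))).map (aeval w)
  · rw [Commute, SemiconjBy, h.right_mul_aeval, prod_comp_C_pow_mul_X_comp, hshift]

variable [NeZero d] [Nontrivial A]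

/-- The `j`-th coefficient of an element of a symbol algebra as a polynomial in `w`: every `v` is
the sum of the products `h.coeffPoly j v (w) * z ^ j`. -/
noncomputable def coeffPoly (h : IsSymbolPair d q a b w z) (j : ZMod d) : A →ₗ[F] F[X] :=
  ∑ i : ZMod d, Polynomial.monomial i.val ∘ₗ h.basis.coord (i, j)

theorem aeval_coeffPoly_mul (j : ZMod d) (v : A) :
    aeval w (h.coeffPoly j v) * z ^ j.val = ∑ i, h.basis.repr v (i, j) • mono w z (i, j) := by
  simp only [coeffPoly, LinearMap.sum_apply, LinearMap.comp_apply, Basis.coord_apply, map_sum,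
    aeval_monomial, sum_mul, mono, Algebra.smul_def, mul_assoc]

theorem sum_aeval_coeffPoly_mul (v : A) :
    ∑ j, aeval w (h.coeffPoly j v) * z ^ j.val = v := by
  simp_rw [aeval_coeffPoly_mul]
  rw [← Fintype.sum_prod_type_right', h.sum_repr_smul_mono]

theorem coeffPoly_eq_zero {j : ZMod d} {v : A} (hv : ∀ i, h.basis.repr v (i, j) = 0) :
    h.coeffPoly j v = 0 := by
  simp [coeffPoly, hv]

theorem repr_aeval_coeffPoly_zero (v : A) (i : ZMod d) :
    h.basis.repr (aeval w (h.coeffPoly 0 v)) (i, 0) = h.basis.repr v (i, 0) := by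
  rw [← mul_one (aeval w _), ← pow_zero z, ← ZMod.val_zero (n := d), aeval_coeffPoly_mul]
  simp [h.repr_mono, Finsupp.single_apply]

theorem eq_aeval_coeffPoly_mul_add [Fact (1 < d)] {v : A}
    (hv : ∀ n, h.basis.repr v n ≠ 0 → n.2 = 0 ∨ n.2 = 1) :
    v = aeval w (h.coeffPoly 1 v) * z + aeval w (h.coeffPoly 0 v) := by
  conv_lhs => rw [← h.sum_aeval_coeffPoly_mul v]
  rw [← sum_subset (subset_univ {1, 0}), sum_pair one_ne_zero, ZMod.val_one, ZMod.val_zero, pow_one,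
    pow_zero, mul_one]
  intro j _ hj
  rw [h.coeffPoly_eq_zero, map_zero, zero_mul]
  intro i
  by_contra hi
  have := hv _ hi
  simp_all

end IsSymbolPair

end CoeffPoly

namespace IsSymbolPair

section Transfer

variable {F A : Type*} [Field F] [Ring A] [Algebra F A] {d : ℕ} [NeZero d] {q a b : F} {w z : A}
  (h : IsSymbolPair d q a b w z)

include h

theorem mono_mono (m n k : ZMod d × ZMod d) :
    ∃ c : Fˣ, mono (mono w z m) (mono w z n) k = c • mono w z (k.1 • m + k.2 • n) := by
  obtain ⟨c, hc⟩ := h.mono_pow m k.1.val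
  obtain ⟨c', hc'⟩ := h.mono_pow n k.2.val
  obtain ⟨c'', hc''⟩ := h.mono_mul_mono (k.1.val • m) (k.2.val • n)
  refine ⟨c * c' * c'', ?_⟩
  rw [mono, hc, hc', smul_mul_smul_comm, hc'', smul_smul, ← Nat.cast_smul_eq_nsmul (ZMod d),
    ← Nat.cast_smul_eq_nsmul (ZMod d), ZMod.natCast_zmod_val, ZMod.natCast_zmod_val]

theorem repr_smul_add_smul_ne_zero [Nontrivial A] {m n : ZMod d × ZMod d} {q' a' b' : F}
    {w' z' : A} (h' : IsSymbolPair d q' a' b' w' z') (hm : mono w z m = w') (hn : mono w z n = z')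
    {v : A} {k : ZMod d × ZMod d} (hk : h'.basis.repr v k ≠ 0) :
    h.basis.repr v (k.1 • m + k.2 • n) ≠ 0 := by
  subst hm hn
  choose c hc using h.mono_mono m n
  have hinj {l : ZMod d × ZMod d} (hl : l.1 • m + l.2 • n = k.1 • m + k.2 • n) : l = k := by
    have hrepr := congr(h'.basis.repr $(hc l) l)
    rw [hl, ← inv_smul_eq_iff.2 (hc k), smul_smul, Units.smul_def, map_smul, h'.repr_mono,
      h'.repr_mono] at hrepr
    by_contra hlk
    simp [Ne.symm hlk] at hrepr
  have hv := congr(h.basis.repr $(h'.sum_repr_smul_mono v) (k.1 • m + k.2 • n))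
  simp only [hc, Units.smul_def, map_sum, map_smul, h.repr_mono, Finsupp.coe_finsetSum,
    Finset.sum_apply, Finsupp.smul_apply] at hv
  rw [← hv, sum_eq_single k (fun l _ hlk => ?_) (by simp)]
  · simpa using hk
  · rw [Finsupp.single_eq_of_ne (mt hinj hlk ∘ Eq.symm), smul_zero, smul_zero]

theorem mem_span_mono_image_iff [Nontrivial A] {s : Finset (ZMod d × ZMod d)} {v : A} :
    v ∈ Submodule.span F (mono (d := d) w z '' s) ↔ ∀ n, h.basis.repr v n ≠ 0 → n ∈ s := by
  have hbasis : (mono w z : ZMod d × ZMod d → A) = h.basis := funext fun n => (h.basis_apply n).symm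
  rw [hbasis, Basis.mem_span_image]
  simp [Set.subset_def]

theorem finrank_span_mono_image [Nontrivial A] (s : Finset (ZMod d × ZMod d)) :
    finrank F (Submodule.span F (mono (d := d) w z '' s)) = #s := by
  rw [Set.image_eq_range]
  refine (finrank_span_eq_card (h.linearIndependent_mono.comp _ Subtype.val_injective)).trans ?_
  exact Fintype.card_coe _

end Transfer

variable {F A : Type*} [Field F] [Ring A] [Algebra F A] {d : ℕ} [Fact (1 < d)] {q a b : F} {w z : A}
  (h : IsSymbolPair d q a b w z)

include h

theorem adjoinMulAddSpan_eq_span_mono (i : ZMod d) :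
    adjoinMulAddSpan F w z (mono w z (i, 0)) = Submodule.span F
      (mono (d := d) w z '' (insert (i, 0) (univ ×ˢ {1}) : Finset (ZMod d × ZMod d))) := by
  refine le_antisymm (sup_le ?_ ?_) (Submodule.span_le.2 ?_)
  · rw [Algebra.adjoin_singleton_eq_range_aeval]
    rintro _ ⟨_, ⟨p, rfl⟩, rfl⟩
    rw [AlgHom.toRingHom_eq_coe, RingHom.coe_coe, Polynomial.aeval_eq_sum_range,
      LinearMap.mulRight_apply, sum_mul]
    refine Submodule.sum_mem _ fun j _ => ?_
    obtain ⟨c, hc⟩ := h.pow_mul_pow_eq_smul_mono j 1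
    rw [pow_one, Nat.cast_one] at hc
    rw [smul_mul_assoc, hc]
    refine Submodule.smul_mem _ _ (Submodule.smul_mem _ c.val (Submodule.subset_span ?_))
    exact ⟨((j : ZMod d), 1), by simp, rfl⟩
  · exact Submodule.span_mono (Set.singleton_subset_iff.2 ⟨(i, 0), by simp, rfl⟩)
  · rintro _ ⟨⟨j, k⟩, hjk, rfl⟩
    rw [mem_coe, mem_insert, mem_product, mem_singleton] at hjk
    rcases hjk with hi | ⟨-, rfl⟩
    · rw [hi]
      exact Submodule.mem_sup_right (Submodule.mem_span_singleton_self _)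
    · refine Submodule.mem_sup_left
        ⟨w ^ j.val, pow_mem (Algebra.self_mem_adjoin_singleton F w) _, ?_⟩
      rw [mono, ZMod.val_one, pow_one, LinearMap.mulRight_apply]

variable [Nontrivial A]

theorem mem_adjoinMulAddSpan_iff {i : ZMod d} {v : A} :
    v ∈ adjoinMulAddSpan F w z (mono w z (i, 0)) ↔
      ∀ n, h.basis.repr v n ≠ 0 → n.2 = 1 ∨ n = (i, 0) := by
  rw [h.adjoinMulAddSpan_eq_span_mono, h.mem_span_mono_image_iff]
  simp [or_comm, eq_comm (a := (1 : ZMod d))]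

theorem finrank_adjoinMulAddSpan (i : ZMod d) :
    finrank F (adjoinMulAddSpan F w z (mono w z (i, 0))) = d + 1 := by
  rw [h.adjoinMulAddSpan_eq_span_mono, h.finrank_span_mono_image, card_insert_of_notMem (by simp)]
  simp [ZMod.card]

end IsSymbolPair

section StandardSpace

open Polynomial

namespace IsSymbolPair

variable {F A : Type*} [Field F] [Ring A] [Nontrivial A] [Algebra F A] {d : ℕ} [Fact d.Prime]
  {q a b : F} {w z : A} (h : IsSymbolPair d q a b w z)

include h

theorem minpoly_left (ha : ∀ c, c ^ d ≠ a) : minpoly F w = X ^ d - C a :=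
  (minpoly.eq_of_irreducible_of_monic (X_pow_sub_C_irreducible_of_prime Fact.out ha)
    (by simp [h.left_pow]) (monic_X_pow_sub_C a (NeZero.ne d))).symm

theorem irreducible_minpoly_left (ha : ∀ c, c ^ d ≠ a) : Irreducible (minpoly F w) :=
  h.minpoly_left ha ▸ X_pow_sub_C_irreducible_of_prime Fact.out ha

theorem isUnit_aeval_left (ha : ∀ c, c ^ d ≠ a) {p : F[X]} (hp : aeval w p ≠ 0) :
    IsUnit (aeval w p) := by
  obtain ⟨r, s, hrs⟩ := (h.irreducible_minpoly_left ha).coprime_iff_not_dvd.2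
    (mt (aeval_eq_zero_of_dvd_aeval_eq_zero · (minpoly.aeval F w)) hp)
  have hs : aeval w (s * p) = 1 := by simpa using congr(aeval w $hrs)
  exact isUnit_iff_exists.2 ⟨aeval w s, by rw [← map_mul, mul_comm, hs], by rw [← map_mul, hs]⟩

omit [Nontrivial A] in
theorem smul_aeval_mul_add_aeval_pow_eq {p g : F[X]} {k : ℕ}
    (hk : (aeval w p * z + aeval w g) ^ k ∈ Set.center A) {s : F} (hs : s ^ d = 1) :
    (s • (aeval w p * z) + aeval w g) ^ k = (aeval w p * z + aeval w g) ^ k := by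
  obtain ⟨e, -, rfl⟩ := h.prim.eq_pow_of_pow_eq_one hs
  have hcomm (p : F[X]) : Commute (w ^ e) (aeval w p) := by
    simpa using (Commute.all (X ^ e) p).map (aeval w)
  have hconj : SemiconjBy (w ^ e) (q ^ e • (aeval w p * z) + aeval w g)
      (aeval w p * z + aeval w g) := by
    refine SemiconjBy.add_right ?_ (hcomm g)
    have hz := h.right_pow_mul_left_pow e 1
    rw [Nat.cast_one, one_mul, pow_one, h.char_natCast] at hz
    rw [SemiconjBy, mul_assoc, hz, mul_smul_comm, mul_smul_comm, ← mul_assoc, ← mul_assoc, hcomm p]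
  refine (h.isUnit_left.pow e).mul_left_cancel ?_
  rw [(hconj.pow_right k).eq, Semigroup.mem_center_iff.1 hk]

theorem aeval_mul_add_aeval_pow_notMem_center (ha : ∀ c, c ^ d ≠ a) {p : F[X]}
    (hp : aeval w p ≠ 0) (g : F[X]) {k : ℕ} (hk : k ≠ 0) (hkd : k < d) :
    (aeval w p * z + aeval w g) ^ k ∉ Set.center A := fun hmem =>
  (((h.isUnit_aeval_left ha hp).mul h.isUnit_right).pow k).ne_zero <|
    pow_eq_zero_of_forall_root_smul_add_pow_eq h.prim hk hkd fun _ hs =>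
      h.smul_aeval_mul_add_aeval_pow_eq hmem hs

omit [Nontrivial A] in
theorem aeval_pow_mem_center {p g : F[X]}
    (hmem : (aeval w p * z + aeval w g) ^ d ∈ Set.center A) : aeval w g ^ d ∈ Set.center A := by
  have hadd := eq_pow_add_pow_of_forall_root_smul_add_pow_eq h.prim fun _ hs =>
    h.smul_aeval_mul_add_aeval_pow_eq hmem hs
  rw [← sub_eq_iff_eq_add'] at hadd
  exact hadd ▸ (Subring.center A).sub_mem hmem (h.aeval_mul_right_pow_mem_center p)

theorem exists_right_mul_aeval_eq_smul (ha : ∀ c, c ^ d ≠ a) {g : F[X]}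
    (hg : aeval w g ^ d ∈ Set.center A) :
    ∃ j, z * aeval w g = h.char j • (aeval w g * z) := by
  have hC : IsPrimitiveRoot (C q) d := h.prim.map_of_injective C_injective
  have hzero : aeval w (g.comp (C q * X) ^ d - g ^ d) = 0 := by
    rw [map_sub, sub_eq_zero, ← h.isUnit_right.mul_left_inj, ← pow_comp, ← h.right_mul_aeval,
      map_pow, Semigroup.mem_center_iff.1 hg]
  have hdvd := minpoly.dvd F w hzero
  rw [hC.pow_sub_pow_eq_prod_sub_mul _ _ (NeZero.pos d),
    (h.irreducible_minpoly_left ha).prime.dvd_finsetProd_iff] at hdvd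
  obtain ⟨ζ, hζ, hdvd⟩ := hdvd
  obtain ⟨j, -, rfl⟩ := hC.eq_pow_of_pow_eq_one ((mem_nthRootsFinset (NeZero.pos d) _).1 hζ)
  have heq := aeval_eq_zero_of_dvd_aeval_eq_zero hdvd (minpoly.aeval F w)
  rw [map_sub, sub_eq_zero] at heq
  refine ⟨j, ?_⟩
  rw [h.right_mul_aeval, heq, h.char_natCast, ← C_pow, map_mul, aeval_C, ← Algebra.smul_def,
    smul_mul_assoc]

theorem exists_forall_repr_ne_zero_imp_eq (ha : ∀ c, c ^ d ≠ a) {v : A}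
    (hv : v ^ d ∈ Set.center A) (hsupp : ∀ n, h.basis.repr v n ≠ 0 → n.2 = 0 ∨ n.2 = 1) :
    ∃ j, ∀ i, h.basis.repr v (i, 0) ≠ 0 → i = j := by
  rw [h.eq_aeval_coeffPoly_mul_add hsupp] at hv
  obtain ⟨j, hj⟩ := h.exists_right_mul_aeval_eq_smul ha (h.aeval_pow_mem_center hv)
  refine ⟨j, fun i hi => h.char_injective ?_⟩
  rw [← h.repr_aeval_coeffPoly_zero] at hi
  have hdet := h.char_det₂_eq_of_mono_mul_eq_smul (k := (0, 1)) (by rwa [mono_zero_one]) hi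
  simpa [det₂] using hdet

theorem exists_le_adjoinMulAddSpan (ha : ∀ c, c ^ d ≠ a) {V : Submodule F A}
    (hV : ∀ v ∈ V, v ^ d ∈ Set.center A)
    (hsupp : ∀ v ∈ V, ∀ n, h.basis.repr v n ≠ 0 → n.2 = 1 ∨ n.2 = 0 ∧ n.1 ≠ 0) :
    ∃ i : ZMod d, i ≠ 0 ∧ V ≤ adjoinMulAddSpan F w z (mono w z (i, 0)) := by
  have hmul {i k : ZMod d} (hik : k ≠ i) (v : A) (hv : v ∈ V) :
      h.basis.coord (i, 0) v * h.basis.coord (k, 0) v = 0 := by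
    obtain ⟨j, hj⟩ := h.exists_forall_repr_ne_zero_imp_eq ha (hV v hv)
      fun n hn => (hsupp v hv n hn).symm.imp_left And.left
    by_contra hne
    exact hik ((hj k (right_ne_zero_of_mul hne)).trans (hj i (left_ne_zero_of_mul hne)).symm)
  obtain ⟨i, hi, hzero⟩ : ∃ i ≠ 0, ∀ k ≠ i, ∀ v ∈ V, h.basis.coord (k, 0) v = 0 := by
    by_cases hall : ∀ k, ∀ v ∈ V, h.basis.coord (k, 0) v = 0
    · exact ⟨1, one_ne_zero, fun k _ => hall k⟩
    · push Not at hall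
      obtain ⟨i, v, hv, hi⟩ := hall
      exact ⟨i, ((hsupp v hv _ hi).resolve_left zero_ne_one).2, fun k hk =>
        (forall_eq_zero_or_of_forall_mul_eq_zero (hmul hk)).resolve_left fun hi' => hi (hi' v hv)⟩
  refine ⟨i, hi, fun v hv => h.mem_adjoinMulAddSpan_iff.2 fun n hn => ?_⟩
  refine (hsupp v hv n hn).imp_right fun hn₂ => ?_
  by_contra hne
  obtain ⟨k, l⟩ := n
  obtain rfl : l = 0 := hn₂.1
  exact hn (hzero k (fun hki => hne (by rw [hki])) v hv)

end IsSymbolPair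

end StandardSpace

section Maximal

open Polynomial

namespace IsSymbolPair

variable {F A : Type*} [Field F] [Ring A] [Nontrivial A] [Algebra F A] {d : ℕ} [Fact d.Prime]
  {q a b : F} {w z : A} (h : IsSymbolPair d q a b w z)

include h

omit [Nontrivial A] in
theorem aeval_mul_add_smul_pow_mem_center (p : F[X]) (c : F) {i : ZMod d} (hi : i ≠ 0) :
    (aeval w p * z + c • mono w z (i, 0)) ^ d ∈ Set.center A := by
  have hw : mono w z (i, 0) = w ^ i.val := by simp [mono]
  have hprim : IsPrimitiveRoot (q ^ i.val) d := h.prim.pow_of_coprime _ <|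
    (ZMod.isUnit_iff_coprime _ _).1 (by rwa [ZMod.natCast_zmod_val, isUnit_iff_ne_zero])
  have hcomm : aeval w p * z * (c • mono w z (i, 0)) =
      q ^ i.val • (c • mono w z (i, 0) * (aeval w p * z)) := by
    have hz := h.right_pow_mul_left_pow i.val 1
    have hp : w ^ i.val * aeval w p = aeval w p * w ^ i.val := by
      simpa using ((Commute.all (X ^ i.val) p).map (aeval w)).eq
    rw [Nat.cast_one, one_mul, pow_one, h.char_natCast] at hz
    rw [hw, mul_smul_comm, mul_assoc, hz, mul_smul_comm, smul_mul_assoc, smul_comm, ← mul_assoc,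
      ← mul_assoc, hp]
  obtain ⟨c', hc'⟩ := h.mono_pow_eq_algebraMap (i, 0)
  rw [add_comm, add_pow_eq_add_pow_of_mul_eq_smul hprim hcomm, _root_.smul_pow, hc']
  exact (Subring.center A).add_mem (Set.smul_mem_center _ (Set.algebraMap_mem_center _))
    (h.aeval_mul_right_pow_mem_center p)

theorem smul_mono_pow_notMem_center {n : ZMod d × ZMod d} (hn : n ≠ 0) {c : F} (hc : c ≠ 0) {k : ℕ}
    (hk : k ≠ 0) (hkd : k < d) : (c • mono w z n) ^ k ∉ Set.center A := by
  intro hmem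
  obtain ⟨c', hc'⟩ := h.mono_pow n k
  have hkn : k • n ≠ 0 := by
    rw [← Nat.cast_smul_eq_nsmul (ZMod d)]
    refine smul_ne_zero (fun hk₀ => ?_) hn
    exact Nat.not_dvd_of_pos_of_lt (Nat.pos_of_ne_zero hk) hkd
      ((ZMod.natCast_eq_zero_iff k d).1 hk₀)
  have hrepr := h.repr_eq_zero_of_mem_center hmem hkn
  rw [_root_.smul_pow, hc'] at hrepr
  simp [h.repr_mono, Units.smul_def, hc] at hrepr

theorem isDCentralSpace_adjoinMulAddSpan (ha : ∀ c, c ^ d ≠ a) {i : ZMod d} (hi : i ≠ 0) :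
    IsDCentralSpace d (adjoinMulAddSpan F w z (mono w z (i, 0))) := by
  intro v hv hv₀
  rw [adjoinMulAddSpan, Submodule.mem_sup] at hv
  obtain ⟨_, ⟨s, hs, rfl⟩, _, hu, rfl⟩ := hv
  rw [Algebra.adjoin_singleton_eq_range_aeval] at hs
  obtain ⟨p, rfl⟩ := hs
  obtain ⟨c, rfl⟩ := Submodule.mem_span_singleton.1 hu
  have hpow {k : ℕ} (hk : k ≠ 0) (hkd : k < d) :
      (aeval w p * z + c • mono w z (i, 0)) ^ k ∉ Set.center A := by
    by_cases hp : aeval w p = 0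
    · rw [hp, zero_mul, zero_add]
      refine h.smul_mono_pow_notMem_center (by simpa using hi) (fun hc => hv₀ ?_) hk hkd
      simp_all
    · have := h.aeval_mul_add_aeval_pow_notMem_center ha hp (C c * X ^ i.val) hk hkd
      simpa [mono, Algebra.smul_def] using this
  refine ⟨?_, h.aeval_mul_add_smul_pow_mem_center p c hi, fun k hk hkd => hpow (by lia) hkd⟩
  simpa using hpow one_ne_zero (Fact.out : d.Prime).one_lt

omit [Nontrivial A] in
theorem aeval_mul_right_pow_eq_zero {c : F} (hc : c ^ d = a) {p : F[X]} (hp : p.eval c = 0)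
    (hp' : p.eval (q * c) = 0) : (aeval w p * z) ^ (d - 1) = 0 := by
  have hc₀ : c ≠ 0 := fun hc₀ => h.left_ne_zero (by rw [← hc, hc₀, zero_pow (NeZero.ne d)])
  have hroots (i : ℕ) (hi : i < d) : ∃ j < d - 1, p.eval (q ^ (j + i) * c) = 0 := by
    have hd := (Fact.out : d.Prime).two_le
    obtain rfl | rfl | hi₂ : i = 0 ∨ i = 1 ∨ 2 ≤ i := by lia
    · exact ⟨0, by lia, by simpa using hp⟩
    · exact ⟨0, by lia, by simpa using hp'⟩
    · refine ⟨d - i, by lia, ?_⟩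
      rwa [Nat.sub_add_cancel hi.le, h.prim.pow_eq_one, one_mul]
  have hdvd : X ^ d - C a ∣ ∏ i ∈ range (d - 1), p.comp (C (q ^ i) * X) := by
    rw [X_pow_sub_C_eq_prod h.prim (NeZero.pos d) hc]
    refine Finset.prod_dvd_of_coprime (fun i hi j hj hij => ?_) fun i hi => ?_
    · refine isCoprime_X_sub_C_of_isUnit_sub (sub_ne_zero.2 fun heq => hij ?_).isUnit
      exact h.prim.pow_inj (mem_range.1 hi) (mem_range.1 hj) (mul_right_cancel₀ hc₀ heq)
    · obtain ⟨j, hj, hroot⟩ := hroots i (mem_range.1 hi)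
      refine dvd_iff_isRoot.2 ?_
      rw [IsRoot.def, eval_prod]
      refine prod_eq_zero (mem_range.2 hj) ?_
      rwa [eval_comp, eval_C_mul, eval_X, ← mul_assoc, ← pow_add]
  rw [h.aeval_mul_right_pow, aeval_eq_zero_of_dvd_aeval_eq_zero hdvd (by simp [h.left_pow]),
    zero_mul]

theorem pow_ne_of_three_le_finrank {V : Submodule F A} (hV : IsDCentralSpace d V)
    (hsupp : ∀ v ∈ V, ∀ n, h.basis.repr v n ≠ 0 → n.2 = 1) (hdim : 3 ≤ finrank F V) (c : F) :
    c ^ d ≠ a := by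
  intro hc
  let φ : A →ₗ[F] F × F :=
    (leval c ∘ₗ h.coeffPoly 1).prod (leval (q * c) ∘ₗ h.coeffPoly 1)
  have := h.finite
  obtain ⟨⟨v, hv⟩, hφ, hne⟩ := Submodule.exists_mem_ne_zero_of_ne_bot <|
    LinearMap.ker_ne_bot_of_finrank_lt (f := φ.domRestrict V)
      (by simpa [Nat.lt_iff_add_one_le] using hdim)
  obtain ⟨hp, hp'⟩ := Prod.ext_iff.1 hφ
  have hpow : (aeval w (h.coeffPoly 1 v) * z) ^ (d - 1) = 0 :=
    h.aeval_mul_right_pow_eq_zero hc hp hp'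
  have hd := (Fact.out : d.Prime).two_le
  refine (hV v hv (by simpa using hne)).2.2 (d - 1) (by lia) (by lia) ?_
  rw [h.eq_aeval_coeffPoly_mul_add fun n hn => .inr (hsupp v hv n hn),
    h.coeffPoly_eq_zero (j := 0) fun i => ?_, map_zero, add_zero, hpow]
  · exact Set.zero_mem_center
  · by_contra hi
    exact zero_ne_one (hsupp v hv _ hi)

theorem finrank_eq_of_maximal {i : ZMod d} (hi : i ≠ 0) {V : Submodule F A}
    (hle : V ≤ adjoinMulAddSpan F w z (mono w z (i, 0))) (hdim : 4 ≤ finrank F V)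
    (hmax : Maximal (fun W : Submodule F A => IsDCentralSpace d W) V) : finrank F V = d + 1 := by
  have := h.finite
  let f : V →ₗ[F] F := (h.basis.coord (i, 0)).domRestrict V
  have hker : 3 ≤ finrank F (f.ker.map V.subtype) := by
    have hrank := f.finrank_range_add_finrank_ker
    have hrange := f.range.finrank_le
    rw [finrank_self] at hrange
    rw [Submodule.finrank_map_subtype_eq]
    lia
  have ha := h.pow_ne_of_three_le_finrank (V := f.ker.map V.subtype)
    (fun v hv => hmax.prop v (Submodule.map_subtype_le _ _ hv)) (fun v hv n hn => ?_) hker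
  · rw [hmax.eq_of_le (h.isDCentralSpace_adjoinMulAddSpan ha hi) hle, h.finrank_adjoinMulAddSpan]
  · obtain ⟨v, hv, rfl⟩ := hv
    refine (h.mem_adjoinMulAddSpan_iff.1 (hle v.2) n hn).resolve_right ?_
    rintro rfl
    exact hn hv

end IsSymbolPair

end Maximal

section DegreeFive

variable {F A : Type*} [Field F] [Ring A] [Algebra F A]

theorem IsDCentralSpace.pow_mem_center {d : ℕ} [NeZero d] {V : Submodule F A}
    (hV : IsDCentralSpace d V) {v : A} (hv : v ∈ V) : v ^ d ∈ Set.center A := by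
  by_cases hv₀ : v = 0
  · rw [hv₀, zero_pow (NeZero.ne d)]
    exact Set.zero_mem_center
  · exact (hV v hv hv₀).2.1

namespace IsSymbolPair

variable {q a b : F} {w z : A} (h : IsSymbolPair 5 q a b w z)

include h

theorem exists_isSymbolPair_pow_mul_pow :
    ∃ q' a' b' : F, IsSymbolPair 5 q' a' b' (w ^ 3 * z ^ 2) w := by
  have hdet : IsUnit (det₂ ((3, 2) : ZMod 5 × ZMod 5) (1, 0)) := ⟨⟨3, 2, rfl, rfl⟩, rfl⟩
  obtain ⟨a', b', h'⟩ := h.isSymbolPair_mono hdet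
  rw [mono_one_zero] at h'
  exact ⟨_, a', b', h'⟩

variable [Nontrivial A] {V : Submodule F A}

theorem le_adjoinMulAddSpan_left
    (hsupp : ∀ v ∈ V, ∀ n, h.basis.repr v n ≠ 0 → IsStandardExponent 0 n) :
    V ≤ adjoinMulAddSpan F w z w := fun v hv => by
  have hmem := h.mem_adjoinMulAddSpan_iff.2 (hsupp v hv)
  rwa [mono_one_zero] at hmem

theorem le_adjoinMulAddSpan_right
    (hsupp : ∀ v ∈ V, ∀ n, h.basis.repr v n ≠ 0 → IsStandardExponent 1 n) :
    V ≤ adjoinMulAddSpan F z w z := by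
  refine h.swap.le_adjoinMulAddSpan_left fun v hv n hn => ?_
  have hstd := hsupp v hv _
    (h.repr_smul_add_smul_ne_zero h.swap (mono_zero_one w z) (mono_one_zero w z) hn)
  simpa [IsStandardExponent, Prod.ext_iff, and_comm] using hstd

theorem repr_ne_zero_of_repr_pow_mul_pow_ne_zero {q' a' b' : F}
    (h' : IsSymbolPair 5 q' a' b' (w ^ 3 * z ^ 2) w) {v : A} {k : ZMod 5 × ZMod 5}
    (hk : h'.basis.repr v k ≠ 0) : h.basis.repr v (3 * k.1 + k.2, 2 * k.1) ≠ 0 := by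
  have hindex : (3 * k.1 + k.2, 2 * k.1) = k.1 • ((3, 2) : ZMod 5 × ZMod 5) + k.2 • (1, 0) := by
    simp [mul_comm]
  rw [hindex]
  exact h.repr_smul_add_smul_ne_zero h' rfl (mono_one_zero w z) hk

theorem pow_ne_of_mono_mem {q' a' b' : F} (h' : IsSymbolPair 5 q' a' b' (w ^ 3 * z ^ 2) w)
    (hV : IsDCentralSpace 5 V) {m : ZMod 5 × ZMod 5} (hm₁ : m ≠ (1, 0)) (hm₂ : m ≠ (0, 1))
    (hm : m.1 + m.2 = 1) (hP : ∀ k ∈ [(1, 0), (0, 1), m], mono w z k ∈ V) (c : F) :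
    c ^ 5 ≠ a' := by
  let s : Finset (ZMod 5 × ZMod 5) := {(1, 0), (0, 1), m}
  have hsV : Submodule.span F (mono (d := 5) w z '' s) ≤ V := by
    rw [Submodule.span_le, Set.image_subset_iff]
    exact fun k hk => hP k (by simpa [s] using hk)
  refine h'.pow_ne_of_three_le_finrank (fun v hv => hV v (hsV hv)) (fun v hv k hk => ?_) ?_ c
  · have hks := h.mem_span_mono_image_iff.1 hv _
      (h.repr_ne_zero_of_repr_pow_mul_pow_ne_zero h' hk)
    have hsum : ∀ n ∈ s, n.1 + n.2 = 1 := by simp [s, hm]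
    have h5 : (5 : ZMod 5) = 0 := rfl
    linear_combination hsum _ hks - k.1 * h5
  · rw [h.finrank_span_mono_image, card_eq_three.2 ⟨_, _, _, ?_, hm₁.symm, hm₂.symm, rfl⟩]
    simp

theorem le_adjoinMulAddSpan_of_mono_mem {q' a' b' : F}
    (h' : IsSymbolPair 5 q' a' b' (w ^ 3 * z ^ 2) w) (hV : IsDCentralSpace 5 V)
    {m : ZMod 5 × ZMod 5} (hm : m.1 + m.2 = 0) (hmV : mono w z m ∈ V)
    (hsupp : ∀ v ∈ V, ∀ n, h.basis.repr v n ≠ 0 → IsStandardExponent 2 n) :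
    V ≤ adjoinMulAddSpan F (w ^ 3 * z ^ 2) w (mono (w ^ 3 * z ^ 2) w (2 * m.1, 0)) := by
  have h5 : (5 : ZMod 5) = 0 := rfl
  refine fun v hv => h'.mem_adjoinMulAddSpan_iff.2 fun k hk => ?_
  have hn := h.repr_ne_zero_of_repr_pow_mul_pow_ne_zero h' hk
  rcases hsupp v hv _ hn with hk₂ | ⟨hk₂, -⟩
  · left
    linear_combination hk₂ - k.1 * h5
  · replace hk₂ : k.2 = 0 := by linear_combination hk₂ - k.1 * h5
    have hdet : det₂ m (3 * k.1 + k.2, 2 * k.1) = 0 := by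
      rw [det₂, hk₂]
      linear_combination m.1 * k.1 * h5 - 3 * k.1 * hm
    have hnm : (3 * k.1 + k.2, 2 * k.1) = m := by
      by_contra hne
      exact hn (h.repr_eq_zero_of_isLinearlyExcluded (P := [m])
        (fun u hu => hV.pow_mem_center hu) hv (by simpa using hmV)
        (.inl ⟨m, by simp, hdet, hne⟩))
    right
    rw [← hnm, hk₂]
    refine Prod.ext ?_ hk₂
    linear_combination -k.1 * h5

theorem exists_le_adjoinMulAddSpan_pow_mul_pow {q' a' b' : F}
    (h' : IsSymbolPair 5 q' a' b' (w ^ 3 * z ^ 2) w) (hV : IsDCentralSpace 5 V)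
    {m : ZMod 5 × ZMod 5} (hm₁ : m ≠ (1, 0)) (hm₂ : m ≠ (0, 1))
    (hP : ∀ k ∈ [(1, 0), (0, 1), m], mono w z k ∈ V)
    (hsupp : ∀ v ∈ V, ∀ n, h.basis.repr v n ≠ 0 → IsStandardExponent 2 n) :
    ∃ i : ZMod 5, i ≠ 0 ∧
      V ≤ adjoinMulAddSpan F (w ^ 3 * z ^ 2) w (mono (w ^ 3 * z ^ 2) w (i, 0)) := by
  have hmV : mono w z m ∈ V := hP m (by simp)
  rcases hsupp _ hmV m (by simp [h.repr_mono]) with hm | ⟨hm, hm₀⟩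
  · refine h'.exists_le_adjoinMulAddSpan (h.pow_ne_of_mono_mem h' hV hm₁ hm₂ hm hP)
      (fun v hv => hV.pow_mem_center hv) fun v hv k hk => ?_
    have h5 : (5 : ZMod 5) = 0 := rfl
    refine (hsupp v hv _ (h.repr_ne_zero_of_repr_pow_mul_pow_ne_zero h' hk)).imp
      (fun hk₂ => ?_) fun ⟨hk₂, hk₀⟩ => ?_
    · linear_combination hk₂ - k.1 * h5
    · replace hk₂ : k.2 = 0 := by linear_combination hk₂ - k.1 * h5
      refine ⟨hk₂, fun hk₁ => hk₀ ?_⟩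
      simp [hk₁, hk₂]
  · refine ⟨2 * m.1, fun hm₁ => hm₀ ?_, h.le_adjoinMulAddSpan_of_mono_mem h' hV hm hmV hsupp⟩
    replace hm₁ : m.1 = 0 := (mul_eq_zero.1 hm₁).resolve_left (by decide)
    exact Prod.ext hm₁ (by rwa [hm₁, zero_add] at hm)

end IsSymbolPair

end DegreeFive

namespace SymbolAlgebra

variable {F : Type*} [Field F] {d : ℕ} {ρ α β : F}

theorem x_pow : x d ρ α β ^ d = algebraMap F _ α := by
  simpa [x] using RingQuot.mkAlgHom_rel F (SymbolRel.x_pow (d := d) (ρ := ρ) (α := α) (β := β))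

theorem y_pow : y d ρ α β ^ d = algebraMap F _ β := by
  simpa [y] using RingQuot.mkAlgHom_rel F (SymbolRel.y_pow (d := d) (ρ := ρ) (α := α) (β := β))

theorem y_mul_x : y d ρ α β * x d ρ α β = ρ • (x d ρ α β * y d ρ α β) := by
  simpa [x, y] using
    RingQuot.mkAlgHom_rel F (SymbolRel.y_mul_x (d := d) (ρ := ρ) (α := α) (β := β))

theorem adjoin_eq_top : Algebra.adjoin F {x d ρ α β, y d ρ α β} = ⊤ := by
  have hrange := congrArg (Subalgebra.map (RingQuot.mkAlgHom F (SymbolRel d ρ α β)))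
    (FreeAlgebra.adjoin_range_ι F (Fin 2))
  rw [AlgHom.map_adjoin, ← Set.range_comp, Algebra.map_top, (AlgHom.range_eq_top _).2
    (RingQuot.mkAlgHom_surjective F _)] at hrange
  rw [← hrange]
  congr 1
  ext
  simp [x, y, eq_comm]

theorem isSymbolPair (hρ : IsPrimitiveRoot ρ d) (hα : α ≠ 0) (hβ : β ≠ 0) :
    IsSymbolPair d ρ α β (x d ρ α β) (y d ρ α β) :=
  ⟨hρ, hα, hβ, x_pow, y_pow, y_mul_x, adjoin_eq_top⟩

end SymbolAlgebra

theorem IsSymbolPair.exists_mono_mem {F A : Type*} [Field F] [Ring A] [Algebra F A] {d : ℕ}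
    [Fact (1 < d)] {q a b : F} {w z : A} (h : IsSymbolPair d q a b w z) {V : Submodule F A}
    {i j : ℕ} (hind : LinearIndependent F ![w, z, w ^ i * z ^ j]) (hmem : w ^ i * z ^ j ∈ V) :
    ∃ m : ZMod d × ZMod d, m ≠ (1, 0) ∧ m ≠ (0, 1) ∧ mono w z m ∈ V := by
  obtain ⟨c, hc⟩ := h.pow_mul_pow_eq_smul_mono i j
  rw [hc] at hind hmem
  refine ⟨_, fun hm => ?_, fun hm => ?_, (V.smul_mem_iff_of_isUnit c.isUnit).1 hmem⟩
  · rw [hm, mono_one_zero] at hind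
    simpa using Fintype.linearIndependent_iff.1 hind ![c, 0, -1]
      (by simp [Fin.sum_univ_three, Units.smul_def]) 2
  · rw [hm, mono_zero_one] at hind
    simpa using Fintype.linearIndependent_iff.1 hind ![0, c, -1]
      (by simp [Fin.sum_univ_three, Units.smul_def]) 2

theorem mainTheorem11_general {F A : Type*} [Field F] [Ring A] [Algebra F A] {ρ α β : F} {x y : A}
    (h : IsSymbolPair 5 ρ α β x y) {V : Submodule F A} (hV : IsDCentralSpace 5 V) (hxV : x ∈ V)
    (hyV : y ∈ V)
    (hij : ∃ i j : ℕ, LinearIndependent F ![x, y, x ^ i * y ^ j] ∧ x ^ i * y ^ j ∈ V) :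
    (V ≤ adjoinMulAddSpan F x y x ∨
      V ≤ adjoinMulAddSpan F y x y ∨
      ∃ i : ℕ, 1 ≤ i ∧ i ≤ 4 ∧
        V ≤ adjoinMulAddSpan F (x ^ 3 * y ^ 2) x ((x ^ 3 * y ^ 2) ^ i)) ∧
    (4 ≤ finrank F V → Maximal (fun W : Submodule F A => IsDCentralSpace 5 W) V →
      finrank F V = 6) := by
  obtain ⟨i, j, hind, hmem⟩ := hij
  have : Nontrivial A := ⟨_, _, hind.ne_zero 0⟩
  obtain ⟨q', a', b', h'⟩ := h.exists_isSymbolPair_pow_mul_pow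
  obtain ⟨m, hm₁, hm₂, hmV⟩ := h.exists_mono_mem hind hmem
  have hP : ∀ k ∈ [(1, 0), (0, 1), m], mono x y k ∈ V := by
    simp [mono_one_zero, mono_zero_one, *]
  obtain ⟨t, ht⟩ := h.exists_forall_isStandardExponent (fun v hv => hV.pow_mem_center hv) hm₁ hm₂ hP
  fin_cases t
  · have hle := h.le_adjoinMulAddSpan_left ht
    exact ⟨.inl hle, h.finrank_eq_of_maximal one_ne_zero (by rwa [mono_one_zero])⟩
  · have hle := h.le_adjoinMulAddSpan_right ht
    exact ⟨.inr (.inl hle), h.swap.finrank_eq_of_maximal one_ne_zero (by rwa [mono_one_zero])⟩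
  · obtain ⟨i, hi, hle⟩ := h.exists_le_adjoinMulAddSpan_pow_mul_pow h' hV hm₁ hm₂ hP ht
    refine ⟨.inr (.inr ⟨i.val, ?_, Nat.le_of_lt_succ i.val_lt, by simpa [mono] using hle⟩),
      h'.finrank_eq_of_maximal hi hle⟩
    exact Nat.one_le_iff_ne_zero.2 ((ZMod.val_ne_zero i).2 hi)

theorem mainTheorem11 {F : Type*} [Field F] [Infinite F] (ρ : F) (hρ : IsPrimitiveRoot ρ 5)
    (α β : F) (hα : α ≠ 0) (hβ : β ≠ 0)
    (x y : SymbolAlgebra 5 ρ α β)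
    (hx : x = SymbolAlgebra.x 5 ρ α β) (hy : y = SymbolAlgebra.y 5 ρ α β)
    (V : Submodule F (SymbolAlgebra 5 ρ α β))
    (hV : IsDCentralSpace 5 V) (hdim : 4 ≤ Module.finrank F V)
    (hxV : x ∈ V) (hyV : y ∈ V)
    (hij : ∃ i j : ℕ, LinearIndependent F ![x, y, x ^ i * y ^ j] ∧ x ^ i * y ^ j ∈ V) :
    (V ≤ adjoinMulAddSpan F x y x ∨
      V ≤ adjoinMulAddSpan F y x y ∨
      ∃ i : ℕ, 1 ≤ i ∧ i ≤ 4 ∧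
        V ≤ adjoinMulAddSpan F (x ^ 3 * y ^ 2) x ((x ^ 3 * y ^ 2) ^ i)) ∧
    (Maximal (fun W : Submodule F (SymbolAlgebra 5 ρ α β) => IsDCentralSpace 5 W) V →
      Module.finrank F V = 6) := by
  subst hx hy
  have h := SymbolAlgebra.isSymbolPair hρ hα hβ
  exact (mainTheorem11_general h hV hxV hyV hij).imp_right (· hdim)
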